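/- **Setting.** Let $P$ be the law of an observation $(X,A,Y)$, where $X$ takes values in a measurable space, $A$ is real-valued and $Y\in\{0,1\}$ almost surely. Assume that $A$ has a conditional density $f(a\mid x)$ given $X=x$ (jointly measurable, with respect to Lebesgue measure) such that for every $x$ the function $a\mapsto f(a\mid x)$ is differentiable on $\mathbb R$ and tends to $0$ as $|a|\to\infty$. Write $'$ for $\partial_a$, and $s(a\mid x)=f'(a\mid x)/f(a\mid x)$. Let $\mu(a,x)$ be a version of $E[Y\mid A=a,X=x]$ such that $\mu(\cdot,x)$ is differentiable at every $a$ with $f(a\mid x)>0$. Fix $\gamma\in\mathbb R$ and $t>0$, and let $$h_t(p)=-\tfrac1t\log\left(e^{-tp}+e^{-t(1-p)}\right).$$ Put $p(A,X)=P(Y=1\mid A,X)$ and define the smoothed bounds $$\psi^B_{\max,h_t}=E[-s(A\mid X)Y]+\gamma E[h_t(p(A,X))],\qquad \psi^B_{\min,h_t}=E[-s(A\mid X)Y]-\gamma E[h_t(p(A,X))],$$ whose (uncentered) efficient influence functions are given by the formulas $$\phi^B_{\max,h_t}=\mu'(A,X)-s(A\mid X)\{Y-\mu(A,X)\}+\gamma\{h_t(p(A,X))+h_t'(p(A,X))(Y-p(A,X))\},$$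 $$\phi^B_{\min,h_t}=\mu'(A,X)-s(A\mid X)\{Y-\mu(A,X)\}-\gamma\{h_t(p(A,X))+h_t'(p(A,X))(Y-p(A,X))\}.$$ **Estimators.** Let $(X_i,A_i,Y_i)_{i\ge1}$ be i.i.d. with law $P$. For each $n$ let $W_n$ be training data independent of $(X_i,A_i,Y_i)_{i\le n}$, and let $\widehat\mu=\widehat\mu_n(\cdot,\cdot;W_n)$ and $\widehat s=\widehat s_n(\cdot\mid\cdot;W_n)$ be jointly measurable functions of the training data and of $(a,x)$, where for every $x$ and every value of the training data $\widehat\mu(\cdot,x)$ is differentiable at every $a$ with $f(a\mid x)>0$. Let $\widehat\mu'=\partial_a\widehat\mu$ (the estimate of $\mu'$ is the derivative of the estimate of $\mu$). The estimators are $$\widehat\psi^B_{\max,h_t}=\frac1n\sum_{i=1}^n\Big[\widehat\mu'(A_i,X_i)-\widehat s(A_i\mid X_i)\{Y_i-\widehat\mu(A_i,X_i)\}+\gamma\big\{h_t(\widehat\mu(A_i,X_i))+h_t'(\widehat\mu(A_i,X_i))(Y_i-\widehat\mu(A_i,X_i))\big\}\Big],$$ and $\widehat\psi^B_{\min,h_t}$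 is given by the same formula with $-\gamma$ in place of $+\gamma$. **Theorem.** Suppose that $\mu'(A,X)$ and $s(A\mid X)$ are almost surely bounded and that, for each $n$, for almost every realization of the training data, the functions $\widehat\mu,\widehat\mu',\widehat s$ are $P$-almost surely bounded functions of $(A,X)$. With $\|\cdot\|$ the $L_2(P)$ norm (the estimates being held fixed), suppose that $$\|\widehat\mu-\mu\|+\|\widehat\mu'-\mu'\|+\|\widehat s-s\|=o_p(n^{-1/4}).$$ Then $$\sqrt n\,(\widehat\psi^B_{\max,h_t}-\psi^B_{\max,h_t})\xrightarrow{d}N\big(0,\operatorname{Var}(\phi^B_{\max,h_t})\big)\quad\text{and}\quad \sqrt n\,(\widehat\psi^B_{\min,h_t}-\psi^B_{\min,h_t})\xrightarrow{d}N\big(0,\operatorname{Var}(\phi^B_{\min,h_t})\big).$$ -/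

import Mathlib

open MeasureTheory ProbabilityTheory Filter Topology
open scoped ENNReal NNReal

namespace ADE

noncomputable section

/-- An observation `(X, A, Y)`: confounders `X`, real-valued exposure `A`, outcome `Y`. -/
abbrev Obs (𝒳 : Type*) := 𝒳 × ℝ × ℝ

/-- The confounders of an observation. -/
abbrev obsX {𝒳 : Type*} (o : Obs 𝒳) : 𝒳 := o.1

/-- The exposure of an observation. -/
abbrev obsA {𝒳 : Type*} (o : Obs 𝒳) : ℝ := o.2.1

/-- The outcome of an observation. -/
abbrev obsY {𝒳 : Type*} (o : Obs 𝒳) : ℝ := o.2.2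

/-- The pair `(A, X)` of an observation. -/
abbrev obsAX {𝒳 : Type*} (o : Obs 𝒳) : ℝ × 𝒳 := (obsA o, obsX o)

/-- The σ-algebra generated by `(A, X)` on the space of observations. -/
abbrev sigmaAX (𝒳 : Type*) [MeasurableSpace 𝒳] : MeasurableSpace (Obs 𝒳) :=
  MeasurableSpace.comap obsAX inferInstance

/-- `f a x = f(a ∣ x)` is (a version of) the conditional density of `A` given `X`, with respect
to Lebesgue measure, when the law of an observation is `P`. -/
structure IsCondDensity {𝒳 : Type*} [MeasurableSpace 𝒳] (P : Measure (Obs 𝒳))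
    (f : ℝ → 𝒳 → ℝ) : Prop where
  measurable : Measurable (Function.uncurry f)
  nonneg : ∀ a x, 0 ≤ f a x
  law_eq : P.map obsAX =
    ((volume : Measure ℝ).prod (P.map obsX)).withDensity (fun q => ENNReal.ofReal (f q.1 q.2))

/-- `m a x = E[Y ∣ A = a, X = x]` is a version of the outcome regression under `P`. -/
structure IsRegression {𝒳 : Type*} [MeasurableSpace 𝒳] (P : Measure (Obs 𝒳))
    (m : ℝ → 𝒳 → ℝ) : Prop where
  measurable : Measurable (Function.uncurry m)
  ae_eq : (fun o => m (obsA o) (obsX o)) =ᵐ[P] P[obsY | sigmaAX 𝒳]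

/-- The conditional probability `P(Y = 1 ∣ A, X)`, as a random variable. -/
def condProbOne {𝒳 : Type*} [MeasurableSpace 𝒳] (P : Measure (Obs 𝒳)) : Obs 𝒳 → ℝ :=
  P⟦{o : Obs 𝒳 | obsY o = 1} | sigmaAX 𝒳⟧

/-- The partial derivative in the exposure, `g'(a, x) = ∂ₐ g(a, x)`. -/
def partialA {𝒳 : Type*} (g : ℝ → 𝒳 → ℝ) (a : ℝ) (x : 𝒳) : ℝ := deriv (fun b => g b x) a

/-- The conditional score `s(a ∣ x) = f'(a ∣ x) / f(a ∣ x)`. -/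
def score {𝒳 : Type*} (f : ℝ → 𝒳 → ℝ) (a : ℝ) (x : 𝒳) : ℝ := partialA f a x / f a x

/-- The LogSumExp approximation of `min p (1 - p)`:
`h_t(p) = -(1/t) log (exp (-t p) + exp (-t (1 - p)))`. -/
def lse (t p : ℝ) : ℝ := -(1 / t) * Real.log (Real.exp (-t * p) + Real.exp (-t * (1 - p)))

/-- The smoothed upper bound `E[-s(A ∣ X) Y] + γ E[h_t(P(Y = 1 ∣ A, X))]`. -/
def psiMax {𝒳 : Type*} [MeasurableSpace 𝒳] (P : Measure (Obs 𝒳)) (f : ℝ → 𝒳 → ℝ)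
    (γ t : ℝ) : ℝ :=
  (∫ o, -score f (obsA o) (obsX o) * obsY o ∂P) + γ * ∫ o, lse t (condProbOne P o) ∂P

/-- The smoothed lower bound `E[-s(A ∣ X) Y] - γ E[h_t(P(Y = 1 ∣ A, X))]`. -/
def psiMin {𝒳 : Type*} [MeasurableSpace 𝒳] (P : Measure (Obs 𝒳)) (f : ℝ → 𝒳 → ℝ)
    (γ t : ℝ) : ℝ :=
  (∫ o, -score f (obsA o) (obsX o) * obsY o ∂P) - γ * ∫ o, lse t (condProbOne P o) ∂P

/-- `μ' - s (y - μ) + γ (h_t(p) + h_t'(p) (y - p))`, as a function of the numbers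
`dm = μ'`, `s`, `m = μ`, `p`, `y`. -/
def eifMax (γ t dm s m p y : ℝ) : ℝ :=
  dm - s * (y - m) + γ * (lse t p + deriv (lse t) p * (y - p))

/-- `μ' - s (y - μ) - γ (h_t(p) + h_t'(p) (y - p))`, as a function of the numbers
`dm = μ'`, `s`, `m = μ`, `p`, `y`. -/
def eifMin (γ t dm s m p y : ℝ) : ℝ :=
  dm - s * (y - m) - γ * (lse t p + deriv (lse t) p * (y - p))

/-- The (uncentered) efficient influence function of the smoothed upper bound. -/
def phiMax {𝒳 : Type*} [MeasurableSpace 𝒳] (P : Measure (Obs 𝒳)) (f m : ℝ → 𝒳 → ℝ)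
    (γ t : ℝ) (o : Obs 𝒳) : ℝ :=
  eifMax γ t (partialA m (obsA o) (obsX o)) (score f (obsA o) (obsX o)) (m (obsA o) (obsX o))
    (condProbOne P o) (obsY o)

/-- The (uncentered) efficient influence function of the smoothed lower bound. -/
def phiMin {𝒳 : Type*} [MeasurableSpace 𝒳] (P : Measure (Obs 𝒳)) (f m : ℝ → 𝒳 → ℝ)
    (γ t : ℝ) (o : Obs 𝒳) : ℝ :=
  eifMin γ t (partialA m (obsA o) (obsX o)) (score f (obsA o) (obsX o)) (m (obsA o) (obsX o))
    (condProbOne P o) (obsY o)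

/-- The one-step estimator of the smoothed upper bound from the observations `z 0, …, z (n - 1)`,
with nuisance estimates `mhat` of `μ` (equivalently of `P(Y = 1 ∣ A, X)`), `∂ₐ mhat` of `μ'`, and
`shat` of `s`. -/
def psiHatMax {𝒳 : Type*} (γ t : ℝ) (mhat shat : ℝ → 𝒳 → ℝ) (n : ℕ) (z : ℕ → Obs 𝒳) : ℝ :=
  (1 / (n : ℝ)) * ∑ i ∈ Finset.range n,
    eifMax γ t (partialA mhat (obsA (z i)) (obsX (z i))) (shat (obsA (z i)) (obsX (z i)))
      (mhat (obsA (z i)) (obsX (z i))) (mhat (obsA (z i)) (obsX (z i))) (obsY (z i))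

/-- The one-step estimator of the smoothed lower bound from the observations `z 0, …, z (n - 1)`,
with the same nuisance estimates as `psiHatMax`. -/
def psiHatMin {𝒳 : Type*} (γ t : ℝ) (mhat shat : ℝ → 𝒳 → ℝ) (n : ℕ) (z : ℕ → Obs 𝒳) : ℝ :=
  (1 / (n : ℝ)) * ∑ i ∈ Finset.range n,
    eifMin γ t (partialA mhat (obsA (z i)) (obsX (z i))) (shat (obsA (z i)) (obsX (z i)))
      (mhat (obsA (z i)) (obsX (z i))) (mhat (obsA (z i)) (obsX (z i))) (obsY (z i))

/-- `g(A, X)` is almost surely bounded under `P`. -/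
def BoundedAS {𝒳 : Type*} [MeasurableSpace 𝒳] (P : Measure (Obs 𝒳)) (g : ℝ → 𝒳 → ℝ) : Prop :=
  ∃ C : ℝ, ∀ᵐ o ∂P, |g (obsA o) (obsX o)| ≤ C

/-- The `L₂(P)` distance `‖g₁ - g₂‖` of two functions of `(A, X)`. -/
def l2dist {𝒳 : Type*} [MeasurableSpace 𝒳] (P : Measure (Obs 𝒳)) (g₁ g₂ : ℝ → 𝒳 → ℝ) : ℝ≥0∞ :=
  eLpNorm (fun o => g₁ (obsA o) (obsX o) - g₂ (obsA o) (obsX o)) 2 P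

/-- The nonnegative random quantities `R n` are `o_p(r n)`. -/
def IsLittleOp {Ω : Type*} [MeasurableSpace Ω] (Pr : Measure Ω) (R : ℕ → Ω → ℝ≥0∞)
    (r : ℕ → ℝ) : Prop :=
  ∀ ε : ℝ, 0 < ε →
    Tendsto (fun n => Pr {ω | ENNReal.ofReal (ε * r n) ≤ R n ω}) atTop (𝓝 0)

end

end ADE

/-! Sample splitting allows the training data to be frozen. Write `v`, `u`, `r` for the errors in
`μ`, `μ'`, `s`, and split the residual as `Y - μhat = (Y - μ) - v`. The estimated influence function
then equals the true one plus `d₁ + d₂`, where `d₁ = (u + s v) + k(A, X) (Y - μ)`, with `k = -r + γ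
(h_t'(μhat) - h_t'(μ))`, `d₂ = r v + γ (h_t(μhat) + h_t'(μhat) (μ - μhat) - h_t(μ))`.

The term `d₁` is linear in the errors but has mean zero. Integration by parts against `f(· ∣ x)`
gives `E[g' + s g] = 0` for both `g = μhat` and `g = μ` (`integral_partialA_add_score_mul`); this is
where `u = ∂ₐ v` is used. The residual `Y - μ` is orthogonal to functions of `(A, X)`
(`integral_mul_residual`). The term `d₂` is quadratic: a product of errors plus a Taylor remainder
of `h_t`, whose second derivative is bounded by `t`.

If the errors are at most `ρ` in `L₂(P)`, then `E[d₁²]` and `E|d₂|` are `O(ρ²)`. After scaling by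
`√n`, Chebyshev bounds the `d₁` average at order `ρ²` and Markov bounds the `d₂` average at order
`√n ρ²`. Both vanish when `ρ = o(n^(-1/4))`. The true influence function has mean `psiMax` by the
same two identities, so the central limit theorem and Slutsky's lemma conclude
(`tendstoInDistribution_crossfit`). The lower bound is the upper bound with `-γ` in place of `γ`. -/

namespace ADE

/-! ### Central limit theorem for averages of functions estimated on independent data. -/

section AbstractCLT

variable {Ω : Type*} [MeasurableSpace Ω] {Pr : Measure Ω} [IsProbabilityMeasure Pr]

/-- If `W` and `V` are independent, the probability of an event about `(W, V)` is bounded by a bound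
for its probability with `W` frozen at good values, plus the probability of bad values. -/
lemma measure_le_add_of_indepFun {𝒲 𝒱 : Type*} [MeasurableSpace 𝒲] [MeasurableSpace 𝒱]
    {W : Ω → 𝒲} {V : Ω → 𝒱} (hW : Measurable W) (hV : Measurable V) (h : IndepFun W V Pr)
    {E : Set (𝒲 × 𝒱)} (hE : MeasurableSet E) {B : Set Ω} {c : ℝ≥0∞}
    (hc : ∀ ω, ω ∉ B → Pr {ω' | (W ω, V ω') ∈ E} ≤ c) :
    Pr {ω | (W ω, V ω) ∈ E} ≤ c + Pr B := by
  -- The joint law is a product by independence, so Tonelli freezes `W`.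
  have h1 : Pr {ω | (W ω, V ω) ∈ E} = ∫⁻ ω, Pr {ω' | (W ω, V ω') ∈ E} ∂Pr := by
    have e : Pr {ω | (W ω, V ω) ∈ E} = Pr.map (fun ω => (W ω, V ω)) E :=
      (Measure.map_apply (hW.prodMk hV) hE).symm
    rw [e, h.map_prod_eq_prod_map_map hW.aemeasurable hV.aemeasurable, Measure.prod_apply hE,
      lintegral_map (measurable_measure_prodMk_left hE) hW]
    refine lintegral_congr fun ω => ?_
    rw [Measure.map_apply hV (measurable_prodMk_left hE)]
    rfl
  rw [h1]
  calc ∫⁻ ω, Pr {ω' | (W ω, V ω') ∈ E} ∂Pr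
      -- `B` need not be measurable (it will be the set where the estimates are bad), hence the
      -- measurable hull.
      ≤ ∫⁻ ω, (c + (toMeasurable Pr B).indicator 1 ω) ∂Pr := by
        refine lintegral_mono fun ω => ?_
        by_cases hω : ω ∈ toMeasurable Pr B
        · simp only [hω, Set.indicator_of_mem, Pi.one_apply]
          exact prob_le_one.trans le_add_self
        · simpa [hω] using hc ω (fun hB => hω (subset_toMeasurable Pr B hB))
    _ = c + Pr B := by
        rw [lintegral_add_left measurable_const, lintegral_indicator_one
          (measurableSet_toMeasurable _ _), measure_toMeasurable]
        simp

variable {S : Type*} [MeasurableSpace S] {P : Measure S}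
  {Z : ℕ → Ω → S}

/-- Chebyshev's inequality for a normalized sum of centered i.i.d. variables. -/
lemma measure_normalized_sum_ge_le (hZ : ∀ i, Measurable (Z i)) (hlaw : ∀ i, Pr.map (Z i) = P)
    (hind : iIndepFun Z Pr) {d : S → ℝ} (hd : MemLp d 2 P) (hd0 : ∫ o, d o ∂P = 0) {n : ℕ}
    (hn : n ≠ 0) {ε : ℝ} (hε : 0 < ε) :
    Pr {ω | ε ≤ |(√(n : ℝ))⁻¹ * ∑ i ∈ Finset.range n, d (Z i ω)|} ≤
      ENNReal.ofReal ((∫ o, d o ^ 2 ∂P) / ε ^ 2) := by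
  have mp : ∀ i, MeasurePreserving (Z i) Pr P := fun i => ⟨hZ i, hlaw i⟩
  have hm : ∀ i, MemLp (d ∘ Z i) 2 Pr := fun i => hd.comp_measurePreserving (mp i)
  have hi : iIndepFun (fun i => d ∘ Z i) Pr :=
    hind.comp₀ (fun _ => d) (fun i => (hZ i).aemeasurable)
      (fun i => by rw [hlaw i]; exact hd.1.aemeasurable)
  have hint : ∀ i, ∫ ω, (d ∘ Z i) ω ∂Pr = 0 := fun i => by
    rw [← hd0, ← hlaw i, integral_map (hZ i).aemeasurable (by rw [hlaw i]; exact hd.1)]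
    rfl
  have hvar : ∀ i, Var[d ∘ Z i; Pr] = ∫ o, d o ^ 2 ∂P := fun i => by
    rw [variance_of_integral_eq_zero (hm i).1.aemeasurable (hint i), ← hlaw i,
      integral_map (hZ i).aemeasurable (by rw [hlaw i]; exact hd.1.pow 2)]
    rfl
  set T : Ω → ℝ := ∑ i ∈ Finset.range n, d ∘ Z i with hT
  have hTm : MemLp T 2 Pr := memLp_finsetSum' _ fun i _ => hm i
  have hTv : Var[T; Pr] = n * ∫ o, d o ^ 2 ∂P := by
    rw [hT, IndepFun.variance_sum (fun i _ => hm i) (fun i _ j _ hij => hi.indepFun hij)]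
    simp [hvar]
  have hT0 : ∫ ω, T ω ∂Pr = 0 := by
    simp only [hT, Finset.sum_apply]
    rw [integral_finsetSum _ fun i _ => (hm i).integrable (by norm_num)]
    exact Finset.sum_eq_zero fun i _ => hint i
  set U : Ω → ℝ := fun ω => (√(n : ℝ))⁻¹ * T ω with hU
  have hUm : MemLp U 2 Pr := hTm.const_mul _
  have hU0 : ∫ ω, U ω ∂Pr = 0 := by rw [hU, integral_const_mul, hT0, mul_zero]
  have hUv : Var[U; Pr] = ∫ o, d o ^ 2 ∂P := by
    rw [hU, variance_const_mul, hTv, inv_pow, Real.sq_sqrt (Nat.cast_nonneg n)]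
    have : (n : ℝ) ≠ 0 := by exact_mod_cast hn
    field_simp
  have := meas_ge_le_variance_div_sq hUm hε
  rw [hU0, hUv] at this
  simpa [hU, hT, Finset.sum_apply] using this

/-- Markov's inequality for a normalized sum of identically distributed variables. -/
lemma measure_normalized_sum_ge_le_of_integrable (hZ : ∀ i, Measurable (Z i))
    (hlaw : ∀ i, Pr.map (Z i) = P) {d : S → ℝ} (hd : Integrable d P) {n : ℕ} (hn : n ≠ 0) {ε : ℝ}
    (hε : 0 < ε) :
    Pr {ω | ε ≤ |(√(n : ℝ))⁻¹ * ∑ i ∈ Finset.range n, d (Z i ω)|} ≤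
      ENNReal.ofReal ((√(n : ℝ) * ∫ o, |d o| ∂P) / ε) := by
  have mp : ∀ i, MeasurePreserving (Z i) Pr P := fun i => ⟨hZ i, hlaw i⟩
  have hi : ∀ i, Integrable (fun ω => |d (Z i ω)|) Pr := fun i =>
    (((mp i).integrable_comp hd.1).2 hd).abs
  have hint : ∀ i, ∫ ω, |d (Z i ω)| ∂Pr = ∫ o, |d o| ∂P := fun i => by
    rw [← hlaw i, integral_map (hZ i).aemeasurable (by rw [hlaw i]; exact hd.abs.1)]
  set U : Ω → ℝ := fun ω => (√(n : ℝ))⁻¹ * ∑ i ∈ Finset.range n, |d (Z i ω)| with hU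
  have hUi : Integrable U Pr := (integrable_finsetSum _ fun i _ => hi i).const_mul _
  have hUint : ∫ ω, U ω ∂Pr = √(n : ℝ) * ∫ o, |d o| ∂P := by
    rw [hU, integral_const_mul, integral_finsetSum _ fun i _ => hi i]
    simp only [hint, Finset.sum_const, Finset.card_range, nsmul_eq_mul, ← mul_assoc]
    congr 1
    have h : √(n : ℝ) ≠ 0 := Real.sqrt_ne_zero'.2 (by positivity)
    rw [inv_mul_eq_iff_eq_mul₀ h, Real.mul_self_sqrt (Nat.cast_nonneg n)]
  have hU0 : 0 ≤ᵐ[Pr] U := Eventually.of_forall fun ω => by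
    simp only [hU, Pi.zero_apply]; positivity
  have hmark := mul_meas_ge_le_integral_of_nonneg hU0 hUi ε
  rw [hUint, mul_comm, ← le_div_iff₀ hε] at hmark
  refine (measure_mono fun ω hω => ?_).trans
    ((ENNReal.le_ofReal_iff_toReal_le (measure_ne_top _ {ω | ε ≤ U ω}) ?_).2 hmark)
  · simp only [Set.mem_ofPred_eq] at hω ⊢
    refine hω.trans ?_
    rw [abs_mul, abs_of_nonneg (by positivity : 0 ≤ (√(n : ℝ))⁻¹)]
    exact mul_le_mul_of_nonneg_left (Finset.abs_sum_le_sum_abs _ _) (by positivity)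
  · have : 0 ≤ ∫ o, |d o| ∂P := integral_nonneg fun _ => abs_nonneg _
    positivity

/-- `g` differs from `φ` by a centered square integrable function plus an integrable function, and
in a sample of size `n` both have a contribution of order `δ`. -/
def IsNegligiblePerturbation (P : Measure S) (φ g : S → ℝ) (n : ℕ) (δ : ℝ) : Prop :=
  ∃ d₁ d₂ : S → ℝ, (∀ᵐ o ∂P, g o = φ o + d₁ o + d₂ o) ∧ MemLp d₁ 2 P ∧ ∫ o, d₁ o ∂P = 0 ∧
    ∫ o, d₁ o ^ 2 ∂P ≤ δ ∧ Integrable d₂ P ∧ √(n : ℝ) * ∫ o, |d₂ o| ∂P ≤ δ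

/-- Half of `ε` goes to each term: Chebyshev for `d₁`, which is centered, and Markov for `d₂`, which
need not be and therefore pays the factor `√n`. -/
lemma IsNegligiblePerturbation.measure_ge_le (hZ : ∀ i, Measurable (Z i))
    (hlaw : ∀ i, Pr.map (Z i) = P) (hind : iIndepFun Z Pr) {φ g : S → ℝ} {n : ℕ} (hn : n ≠ 0)
    {δ ε : ℝ} (hε : 0 < ε) (h : IsNegligiblePerturbation P φ g n δ) :
    Pr {ω | ε ≤ |(√(n : ℝ))⁻¹ * ∑ i ∈ Finset.range n, (g (Z i ω) - φ (Z i ω))|} ≤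
      ENNReal.ofReal (δ / (ε / 2) ^ 2) + ENNReal.ofReal (δ / (ε / 2)) := by
  obtain ⟨d₁, d₂, hg, h1, h10, h1δ, h2, h2δ⟩ := h
  have hε2 : 0 < ε / 2 := half_pos hε
  have hall : ∀ᵐ ω ∂Pr, ∀ i, g (Z i ω) = φ (Z i ω) + d₁ (Z i ω) + d₂ (Z i ω) := by
    refine ae_all_iff.2 fun i => ?_
    rw [← hlaw i] at hg
    exact ae_of_ae_map (hZ i).aemeasurable hg
  calc _ ≤ Pr ({ω | ε / 2 ≤ |(√(n : ℝ))⁻¹ * ∑ i ∈ Finset.range n, d₁ (Z i ω)|} ∪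
          {ω | ε / 2 ≤ |(√(n : ℝ))⁻¹ * ∑ i ∈ Finset.range n, d₂ (Z i ω)|}) := by
        refine measure_mono_ae ?_
        filter_upwards [hall] with ω hω hmem
        change ε ≤ _ at hmem
        change ε / 2 ≤ _ ∨ ε / 2 ≤ _
        by_contra! hcon
        have e : ∑ i ∈ Finset.range n, (g (Z i ω) - φ (Z i ω)) =
            ∑ i ∈ Finset.range n, d₁ (Z i ω) + ∑ i ∈ Finset.range n, d₂ (Z i ω) := by
          rw [← Finset.sum_add_distrib]
          exact Finset.sum_congr rfl fun i _ => by rw [hω i]; ring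
        rw [e, mul_add] at hmem
        linarith [abs_add_le ((√(n : ℝ))⁻¹ * ∑ i ∈ Finset.range n, d₁ (Z i ω))
          ((√(n : ℝ))⁻¹ * ∑ i ∈ Finset.range n, d₂ (Z i ω))]
    _ ≤ _ := by
        refine (measure_union_le _ _).trans (add_le_add ?_ ?_)
        · exact (measure_normalized_sum_ge_le hZ hlaw hind h1 h10 hn hε2).trans
            (ENNReal.ofReal_le_ofReal (by gcongr))
        · exact (measure_normalized_sum_ge_le_of_integrable hZ hlaw h2 hn hε2).trans
            (ENNReal.ofReal_le_ofReal (by gcongr))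

/-- Asymptotic normality of a cross-fitted average: if, with probability tending to one, the
estimated function is a negligible perturbation of `φ`, then the average is asymptotically normal
with the variance of `φ`. -/
theorem tendstoInDistribution_crossfit (hZ : ∀ i, Measurable (Z i))
    (hlaw : ∀ i, Pr.map (Z i) = P) (hind : iIndepFun Z Pr)
    {𝒲 : ℕ → Type*} [∀ n, MeasurableSpace (𝒲 n)]
    {W : (n : ℕ) → Ω → 𝒲 n} (hW : ∀ n, Measurable (W n))
    (hWZ : ∀ n, IndepFun (W n) (fun ω (i : Fin n) => Z i ω) Pr)
    {φ : S → ℝ} (hφm : Measurable φ) (hφ : MemLp φ 2 P)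
    {Φ : (n : ℕ) → 𝒲 n → S → ℝ} (hΦ : ∀ n, Measurable (Function.uncurry (Φ n)))
    (hgood : ∀ δ : ℝ, 0 < δ → Tendsto
      (fun n => Pr {ω | ¬ IsNegligiblePerturbation P φ (Φ n (W n ω)) n δ}) atTop (𝓝 0)) :
    TendstoInDistribution
      (fun (n : ℕ) ω => √(n : ℝ) *
        ((1 / (n : ℝ)) * ∑ i ∈ Finset.range n, Φ n (W n ω) (Z i ω) - ∫ o, φ o ∂P))
      atTop (id : ℝ → ℝ) (fun _ => Pr) (gaussianReal 0 (Var[φ; P]).toNNReal) := by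
  have mp : ∀ i, MeasurePreserving (Z i) Pr P := fun i => ⟨hZ i, hlaw i⟩
  have hvar : Var[φ ∘ Z 0; Pr] = Var[φ; P] := (mp 0).variance_fun_comp hφ.1.aemeasurable
  have hmean : ∫ ω, (φ ∘ Z 0) ω ∂Pr = ∫ o, φ o ∂P := by
    rw [← hlaw 0, integral_map (hZ 0).aemeasurable (by rw [hlaw 0]; exact hφ.1)]
    rfl
  have hclt : TendstoInDistribution
      (fun (n : ℕ) ω => (√(n : ℝ))⁻¹ * (∑ k ∈ Finset.range n, (φ ∘ Z k) ω - n * Pr[φ ∘ Z 0]))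
      atTop (id : ℝ → ℝ) (fun _ => Pr) (gaussianReal 0 (Var[φ; P]).toNNReal) := by
    refine tendstoInDistribution_inv_sqrt_mul_sum_sub (X := fun k => φ ∘ Z k) ?_
      (hφ.comp_measurePreserving (mp 0)) (hind.comp (fun _ => φ) fun _ => hφm) fun i => ?_
    · rw [hvar]
      exact ⟨aemeasurable_id, Measure.map_id⟩
    · exact (IdentDistrib.mk (hZ i).aemeasurable (hZ 0).aemeasurable
        (by rw [hlaw i, hlaw 0])).comp hφm
  have hmeas : ∀ n : ℕ, Measurable fun ω => √(n : ℝ) *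
        ((1 / (n : ℝ)) * ∑ i ∈ Finset.range n, Φ n (W n ω) (Z i ω) - ∫ o, φ o ∂P) := fun n => by
    refine measurable_const.mul ((measurable_const.mul
      (Finset.measurable_fun_sum _ fun i _ => ?_)).sub measurable_const)
    exact (hΦ n).comp ((hW n).prodMk (hZ i))
  -- Slutsky: it remains to show that the difference from the normalized sum of `φ` tends to zero in
  -- probability.
  refine tendstoInDistribution_of_tendstoInMeasure_sub _ _ hclt ?_ fun n => (hmeas n).aemeasurable
  rw [tendstoInMeasure_iff_norm]
  intro ε hε
  have key : ∀ n : ℕ, n ≠ 0 → ∀ ω, √(n : ℝ) *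
        ((1 / (n : ℝ)) * ∑ i ∈ Finset.range n, Φ n (W n ω) (Z i ω) - ∫ o, φ o ∂P) -
      (√(n : ℝ))⁻¹ * (∑ k ∈ Finset.range n, (φ ∘ Z k) ω - n * Pr[φ ∘ Z 0]) =
      (√(n : ℝ))⁻¹ * ∑ i ∈ Finset.range n, (Φ n (W n ω) (Z i ω) - φ (Z i ω)) := fun n hn ω => by
    rw [hmean, Finset.sum_sub_distrib]
    have h : √(n : ℝ) ≠ 0 := Real.sqrt_ne_zero'.2 (by positivity)
    have h2 : (n : ℝ) = √(n : ℝ) * √(n : ℝ) := (Real.mul_self_sqrt (Nat.cast_nonneg n)).symm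
    generalize √(n : ℝ) = r at h h2 ⊢
    rw [h2]
    simp only [Function.comp_apply]
    field_simp
    ring
  have hbound : ∀ δ : ℝ, ∀ n : ℕ, n ≠ 0 →
      Pr {ω | ε ≤ |(√(n : ℝ))⁻¹ * ∑ i ∈ Finset.range n, (Φ n (W n ω) (Z i ω) - φ (Z i ω))|} ≤
      (ENNReal.ofReal (δ / (ε / 2) ^ 2) + ENNReal.ofReal (δ / (ε / 2))) +
        Pr {ω | ¬ IsNegligiblePerturbation P φ (Φ n (W n ω)) n δ} := fun δ n hn => by
    -- The training data are independent of the first `n` observations only, so the event is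
    -- expressed through `Fin n`.
    let E : Set (𝒲 n × (Fin n → S)) :=
      {q | ε ≤ |(√(n : ℝ))⁻¹ * ∑ i : Fin n, (Φ n q.1 (q.2 i) - φ (q.2 i))|}
    have hE : MeasurableSet E := by
      refine measurableSet_le measurable_const (Measurable.abs (measurable_const.mul
        (Finset.measurable_fun_sum _ fun i _ => ?_)))
      refine Measurable.sub ((hΦ n).comp (measurable_fst.prodMk
        ((measurable_pi_apply i).comp measurable_snd))) ?_
      exact hφm.comp ((measurable_pi_apply i).comp measurable_snd)
    have hsum : ∀ (w : 𝒲 n) ω, ∑ i ∈ Finset.range n, (Φ n w (Z i ω) - φ (Z i ω)) =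
        ∑ i : Fin n, (Φ n w (Z i ω) - φ (Z i ω)) := fun w ω =>
      Finset.sum_range fun i => Φ n w (Z i ω) - φ (Z i ω)
    simp only [hsum]
    refine measure_le_add_of_indepFun (V := fun ω (i : Fin n) => Z i ω) (hW n)
      (measurable_pi_lambda _ fun i => hZ i) (hWZ n) hE fun ω hω => ?_
    have hω' : IsNegligiblePerturbation P φ (Φ n (W n ω)) n δ := by simpa using hω
    have := hω'.measure_ge_le hZ hlaw hind hn hε
    simp only [hsum] at this
    exact this
  rw [ENNReal.tendsto_nhds_zero]
  intro η hη
  have hlim : Tendsto (fun δ : ℝ => ENNReal.ofReal (δ / (ε / 2) ^ 2) +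
      ENNReal.ofReal (δ / (ε / 2))) (𝓝[>] 0) (𝓝 0) := by
    have h1 : Tendsto (fun δ : ℝ => δ / (ε / 2) ^ 2) (𝓝[>] 0) (𝓝 0) := by
      have := (tendsto_id (α := ℝ) (x := 𝓝 0)).div_const ((ε / 2) ^ 2)
      simpa using this.mono_left nhdsWithin_le_nhds
    have h2 : Tendsto (fun δ : ℝ => δ / (ε / 2)) (𝓝[>] 0) (𝓝 0) := by
      have := (tendsto_id (α := ℝ) (x := 𝓝 0)).div_const (ε / 2)
      simpa using this.mono_left nhdsWithin_le_nhds
    simpa using (ENNReal.tendsto_ofReal h1).add (ENNReal.tendsto_ofReal h2)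
  have hη2 : 0 < η / 2 := ENNReal.half_pos hη.ne'
  -- `δ` is fixed before `n`: it makes the Chebyshev and Markov bounds small uniformly in `n`, and
  -- then large `n` makes the bad event rare.
  obtain ⟨δ, hδη, hδ⟩ := ((ENNReal.tendsto_nhds_zero.1 hlim _ hη2).and self_mem_nhdsWithin).exists
  filter_upwards [ENNReal.tendsto_nhds_zero.1 (hgood δ hδ) _ hη2, eventually_ne_atTop 0]
    with n hn hn0
  simp only [Pi.sub_apply, Pi.zero_apply, sub_zero, Real.norm_eq_abs, key n hn0]
  exact (hbound δ n hn0).trans ((add_le_add hδη hn).trans (ENNReal.add_halves η).le)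

end AbstractCLT

/-! ### Derivative bounds for the smoothed minimum. -/

section LogSumExp

lemma hasDerivAt_lse {t : ℝ} (ht : 0 < t) (p : ℝ) :
    HasDerivAt (lse t) ((Real.exp (-t * p) - Real.exp (-t * (1 - p))) /
      (Real.exp (-t * p) + Real.exp (-t * (1 - p)))) p := by
  have hu : HasDerivAt (fun p => Real.exp (-t * p)) (Real.exp (-t * p) * (-t * 1)) p :=
    ((hasDerivAt_id p).const_mul (-t)).exp
  have hv : HasDerivAt (fun p => Real.exp (-t * (1 - p)))
      (Real.exp (-t * (1 - p)) * (-t * (0 - 1))) p :=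
    (((hasDerivAt_const p (1 : ℝ)).sub (hasDerivAt_id p)).const_mul (-t)).exp
  have hpos : 0 < Real.exp (-t * p) + Real.exp (-t * (1 - p)) := by positivity
  refine (((hu.add hv).log hpos.ne').const_mul (-(1 / t))).congr_deriv ?_
  simp only [Pi.add_apply]
  field_simp
  ring

lemma deriv_lse {t : ℝ} (ht : 0 < t) : deriv (lse t) = fun p =>
    (Real.exp (-t * p) - Real.exp (-t * (1 - p))) /
      (Real.exp (-t * p) + Real.exp (-t * (1 - p))) :=
  funext fun p => (hasDerivAt_lse ht p).deriv

lemma hasDerivAt_deriv_lse {t : ℝ} (ht : 0 < t) (p : ℝ) :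
    HasDerivAt (deriv (lse t)) (-(4 * t * (Real.exp (-t * p) * Real.exp (-t * (1 - p)))) /
      (Real.exp (-t * p) + Real.exp (-t * (1 - p))) ^ 2) p := by
  rw [deriv_lse ht]
  have hu : HasDerivAt (fun p => Real.exp (-t * p)) (Real.exp (-t * p) * (-t * 1)) p :=
    ((hasDerivAt_id p).const_mul (-t)).exp
  have hv : HasDerivAt (fun p => Real.exp (-t * (1 - p)))
      (Real.exp (-t * (1 - p)) * (-t * (0 - 1))) p :=
    (((hasDerivAt_const p (1 : ℝ)).sub (hasDerivAt_id p)).const_mul (-t)).exp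
  have hpos : 0 < Real.exp (-t * p) + Real.exp (-t * (1 - p)) := by positivity
  refine ((hu.sub hv).div (hu.add hv) hpos.ne').congr_deriv ?_
  simp only [Pi.add_apply, Pi.sub_apply]
  congr 1
  ring

lemma abs_deriv_lse_le {t : ℝ} (ht : 0 < t) (p : ℝ) : |deriv (lse t) p| ≤ 1 := by
  rw [deriv_lse ht]
  have hu := Real.exp_pos (-t * p)
  have hv := Real.exp_pos (-t * (1 - p))
  simp only [abs_div, abs_of_pos (add_pos hu hv)]
  rw [div_le_one (add_pos hu hv), abs_le]
  constructor <;> linarith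

/-- With `u`, `v` the two exponentials, `|h_t''| = 4 t u v / (u + v)²`, which is at most `t` because
`(u - v)² ≥ 0`. -/
lemma abs_deriv_lse_sub_le {t : ℝ} (ht : 0 < t) (p q : ℝ) :
    |deriv (lse t) q - deriv (lse t) p| ≤ t * |q - p| := by
  refine Convex.norm_image_sub_le_of_norm_hasDerivWithin_le (s := Set.univ)
    (fun x _ => (hasDerivAt_deriv_lse ht x).hasDerivWithinAt) (fun x _ => ?_) convex_univ
    (Set.mem_univ p) (Set.mem_univ q)
  have hu := Real.exp_pos (-t * x)
  have hv := Real.exp_pos (-t * (1 - x))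
  generalize Real.exp (-t * x) = u at hu ⊢
  generalize Real.exp (-t * (1 - x)) = v at hv ⊢
  rw [norm_div, Real.norm_eq_abs, Real.norm_eq_abs, abs_neg, abs_of_pos (by positivity),
    abs_of_pos (by positivity), div_le_iff₀ (by positivity)]
  nlinarith [mul_nonneg ht.le (sq_nonneg (u - v))]

/-- Mean value inequality for `y ↦ h_t(y) - h_t'(q) y` between `q` and `p`, whose derivative there
is at most `t |p - q|`. No restriction to `[0, 1]` is imposed, since `μhat` may leave that interval.
-/
lemma abs_lse_taylor_le {t : ℝ} (ht : 0 < t) (p q : ℝ) :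
    |lse t q + deriv (lse t) q * (p - q) - lse t p| ≤ t * (p - q) ^ 2 := by
  have h := Convex.norm_image_sub_le_of_norm_hasDerivWithin_le (s := Set.uIcc q p)
    (f := fun y => lse t y - deriv (lse t) q * y)
    (f' := fun y => deriv (lse t) y - deriv (lse t) q * 1) (C := t * |p - q|) (x := q) (y := p)
    (fun y _ => ((hasDerivAt_lse ht y).differentiableAt.hasDerivAt.sub
      ((hasDerivAt_id y).const_mul _)).hasDerivWithinAt) (fun y hy => ?_) (convex_uIcc q p)
    Set.left_mem_uIcc Set.right_mem_uIcc
  · rw [Real.norm_eq_abs, Real.norm_eq_abs] at h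
    calc _ = |lse t p - deriv (lse t) q * p - (lse t q - deriv (lse t) q * q)| := by
          rw [← abs_neg]; congr 1; ring
      _ ≤ t * |p - q| * |p - q| := h
      _ = t * (p - q) ^ 2 := by rw [mul_assoc, abs_mul_abs_self, sq]
  · rw [mul_one, Real.norm_eq_abs]
    exact (abs_deriv_lse_sub_le ht q y).trans
      (mul_le_mul_of_nonneg_left (Set.abs_sub_left_of_mem_uIcc hy) ht.le)

lemma continuous_lse {t : ℝ} (ht : 0 < t) : Continuous (lse t) :=
  continuous_iff_continuousAt.2 fun p => (hasDerivAt_lse ht p).continuousAt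

lemma continuous_deriv_lse {t : ℝ} (ht : 0 < t) : Continuous (deriv (lse t)) :=
  continuous_iff_continuousAt.2 fun p => (hasDerivAt_deriv_lse ht p).continuousAt

end LogSumExp

/-! ### Integration by parts on the line, with a density that may vanish. -/

section OneDim

/-- Where a nonnegative density vanishes, so does its derivative, so the product with a bounded
function which is differentiable on the support is differentiable everywhere. -/
lemma hasDerivAt_mul_density {p g : ℝ → ℝ} (hp0 : ∀ a, 0 ≤ p a) (hp : Differentiable ℝ p)
    (hg : ∀ a, 0 < p a → DifferentiableAt ℝ g a) {C : ℝ} (hC : ∀ a, 0 < p a → |g a| ≤ C) (a : ℝ) :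
    HasDerivAt (fun b => g b * p b) (deriv g a * p a + g a * deriv p a) a := by
  rcases (hp0 a).lt_or_eq with h | h
  · exact (hg a h).hasDerivAt.mul (hp a).hasDerivAt
  · have hmin : IsLocalMin p a := Eventually.of_forall fun b => h ▸ hp0 b
    have hd : deriv p a = 0 := hmin.deriv_eq_zero
    have hpd : HasDerivAt p 0 a := hd ▸ (hp a).hasDerivAt
    rw [hd, ← h, mul_zero, mul_zero, add_zero]
    rw [hasDerivAt_iff_isLittleO] at hpd ⊢
    -- At a zero of `p` the product is dominated by `C p`, and `p` is `o(b - a)` there, so nothing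
    -- is needed of `g` at `a` itself.
    refine Asymptotics.IsBigO.trans_isLittleO ?_ hpd
    refine Asymptotics.IsBigO.of_bound C (Eventually.of_forall fun b => ?_)
    simp only [← h, mul_zero, sub_zero, smul_zero, norm_mul, Real.norm_eq_abs]
    rcases (hp0 b).lt_or_eq with hb | hb
    · exact mul_le_mul_of_nonneg_right (hC b hb) (abs_nonneg _)
    · simp [← hb]

/-- Integration by parts against a density vanishing at infinity. -/
lemma integral_deriv_mul_density {p g : ℝ → ℝ} (hp0 : ∀ a, 0 ≤ p a) (hp : Differentiable ℝ p)
    (htop : Tendsto p atTop (𝓝 0)) (hbot : Tendsto p atBot (𝓝 0))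
    (hg : ∀ a, 0 < p a → DifferentiableAt ℝ g a) {C : ℝ} (hC : ∀ a, 0 < p a → |g a| ≤ C)
    (hint : Integrable (fun a => deriv g a * p a + g a * deriv p a)) :
    ∫ a, (deriv g a * p a + g a * deriv p a) = 0 := by
  have hle : ∀ a, ‖g a * p a‖ ≤ C * p a := fun a => by
    rw [Real.norm_eq_abs, abs_mul, abs_of_nonneg (hp0 a)]
    rcases (hp0 a).lt_or_eq with h | h
    · exact mul_le_mul_of_nonneg_right (hC a h) h.le
    · simp [← h]
  rw [integral_of_hasDerivAt_of_tendsto (hasDerivAt_mul_density hp0 hp hg hC) hint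
    (squeeze_zero_norm hle (by simpa using hbot.const_mul C))
    (squeeze_zero_norm hle (by simpa using htop.const_mul C)), sub_zero]

end OneDim

/-! ### Joint measurability of partial derivatives. -/

section Measurability

variable {𝒳 : Type*} [MeasurableSpace 𝒳]

/-- The partial derivative, cut off outside the support of `f`, is jointly measurable as soon as the
function is, even with a parameter. -/
lemma measurable_indicator_partialA {𝒲 : Type*} [MeasurableSpace 𝒲] {f : ℝ → 𝒳 → ℝ}
    (hf : Measurable (Function.uncurry f)) {g : 𝒲 → ℝ → 𝒳 → ℝ}
    (hg : Measurable fun q : 𝒲 × ℝ × 𝒳 => g q.1 q.2.1 q.2.2)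
    (hd : ∀ w x a, 0 < f a x → DifferentiableAt ℝ (fun b => g w b x) a) :
    Measurable ({q : 𝒲 × ℝ × 𝒳 | 0 < f q.2.1 q.2.2}.indicator
      fun q => partialA (g q.1) q.2.1 q.2.2) := by
  have hS : MeasurableSet {q : 𝒲 × ℝ × 𝒳 | 0 < f q.2.1 q.2.2} :=
    measurableSet_lt measurable_const (hf.comp measurable_snd)
  let h : ℕ → ℝ := fun k => 1 / ((k : ℝ) + 1)
  have hpos : ∀ k, 0 < h k := fun k => Nat.one_div_pos_of_nat
  have hlim : Tendsto h atTop (𝓝[≠] 0) :=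
    tendsto_nhdsWithin_iff.2 ⟨tendsto_one_div_add_atTop_nhds_zero_nat,
      Eventually.of_forall fun k => (hpos k).ne'⟩
  -- On the support the derivative is the limit of difference quotients with steps `1 / (k + 1)`;
  -- off it both sides are zero.
  refine measurable_of_tendsto_metrizable (f := fun (k : ℕ) =>
    {q : 𝒲 × ℝ × 𝒳 | 0 < f q.2.1 q.2.2}.indicator fun q =>
      (h k)⁻¹ * (g q.1 (q.2.1 + h k) q.2.2 - g q.1 q.2.1 q.2.2)) (fun k => ?_) ?_
  · refine Measurable.indicator (measurable_const.mul (Measurable.sub ?_ hg)) hS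
    exact hg.comp (measurable_fst.prodMk
      ((measurable_snd.fst.add_const (h k)).prodMk measurable_snd.snd))
  · rw [tendsto_pi_nhds]
    intro q
    by_cases hq : 0 < f q.2.1 q.2.2
    · have := (hasDerivAt_iff_tendsto_slope_zero.1 (hd q.1 q.2.2 q.2.1 hq).hasDerivAt).comp hlim
      simpa [Set.indicator, hq, Function.comp_def, partialA] using this
    · simp [Set.indicator, hq]

lemma measurable_partialA {f : ℝ → 𝒳 → ℝ} (hf : Measurable (Function.uncurry f))
    (hd : ∀ x, Differentiable ℝ fun a => f a x) :
    Measurable fun q : ℝ × 𝒳 => partialA f q.1 q.2 := by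
  -- The constant density `1` makes the cut-off disappear, and `Unit` the parameter.
  have h := measurable_indicator_partialA (𝒲 := Unit) (f := fun _ (_ : 𝒳) => (1 : ℝ))
    measurable_const (g := fun _ => f) (hf.comp measurable_snd) fun _ x a _ => hd x a
  simpa [Function.comp_def] using h.comp (measurable_const (a := ()).prodMk measurable_id)

end Measurability

/-! ### The support of the conditional density, and integration by parts under `P`. -/

section Support

/-- A bound which holds almost everywhere on the support of a continuous density holds everywhere
on it, for a function which is continuous there. -/
lemma abs_le_of_ae_abs_le {p g : ℝ → ℝ} (hp : Continuous p)
    (hg : ∀ a, 0 < p a → ContinuousAt g a) {C : ℝ} (h : ∀ᵐ a, 0 < p a → |g a| ≤ C)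
    (a : ℝ) (ha : 0 < p a) : |g a| ≤ C := by
  by_contra! hcon
  -- By continuity the bound would fail on a neighbourhood of `a`, which has positive Lebesgue
  -- measure.
  have hU : {b | ¬ (0 < p b → |g b| ≤ C)} ∈ 𝓝 a := by
    filter_upwards [hp.continuousAt.eventually (lt_mem_nhds ha),
      (hg a ha).abs.eventually (lt_mem_nhds hcon)] with b hb hb'
    simpa [hb] using hb'
  exact (Measure.measure_pos_of_mem_nhds volume hU).ne' h

variable {𝒳 : Type*} [MeasurableSpace 𝒳] {P : Measure (Obs 𝒳)} {f : ℝ → 𝒳 → ℝ}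

lemma measurable_obsAX : Measurable (obsAX : Obs 𝒳 → ℝ × 𝒳) := by fun_prop

lemma IsCondDensity.measurable_ofReal (hf : IsCondDensity P f) :
    Measurable fun q : ℝ × 𝒳 => ENNReal.ofReal (f q.1 q.2) :=
  hf.measurable.ennreal_ofReal

lemma IsCondDensity.ae_pos (hf : IsCondDensity P f) : ∀ᵐ o ∂P, 0 < f (obsA o) (obsX o) := by
  have h : ∀ᵐ q ∂(P.map obsAX), 0 < f q.1 q.2 := by
    rw [hf.law_eq, ae_withDensity_iff hf.measurable_ofReal]
    refine Eventually.of_forall fun q hq => ?_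
    by_contra! hcon
    exact hq (ENNReal.ofReal_eq_zero.2 hcon)
  exact ae_of_ae_map measurable_obsAX.aemeasurable h

/-- An almost sure property of `(A, X)` holds, for almost every `x`, almost everywhere on the
support of `f(· ∣ x)`. -/
lemma IsCondDensity.ae_ae_of_ae [SFinite P] (hf : IsCondDensity P f) {s : Set (ℝ × 𝒳)}
    (hs : MeasurableSet s) (h : ∀ᵐ o ∂P, obsAX o ∈ s) :
    ∀ᵐ x ∂(P.map obsX), ∀ᵐ a, 0 < f a x → (a, x) ∈ s := by
  have h1 : ∀ᵐ q ∂(P.map obsAX), q ∈ s := (ae_map_iff measurable_obsAX.aemeasurable hs).2 h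
  rw [hf.law_eq, ae_withDensity_iff hf.measurable_ofReal, ← Measure.prod_swap] at h1
  have h2 := Measure.ae_ae_of_ae_prod (ae_of_ae_map measurable_swap.aemeasurable h1)
  filter_upwards [h2] with x hx
  filter_upwards [hx] with a ha hpos
  exact ha (by simpa using hpos)

lemma IsCondDensity.aemeasurable_partialA (hf : IsCondDensity P f) {g : ℝ → 𝒳 → ℝ}
    (hg : Measurable (Function.uncurry g))
    (hd : ∀ x a, 0 < f a x → DifferentiableAt ℝ (fun b => g b x) a) :
    AEMeasurable (fun o => partialA g (obsA o) (obsX o)) P := by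
  have hm := measurable_indicator_partialA (𝒲 := Unit) hf.measurable (g := fun _ => g)
    (hg.comp measurable_snd) fun _ => hd
  refine ⟨_, hm.comp (measurable_const (a := ()).prodMk measurable_obsAX), ?_⟩
  filter_upwards [hf.ae_pos] with o ho
  simp [Set.indicator, ho]

lemma IsCondDensity.measurable_score (hf : IsCondDensity P f)
    (hd : ∀ x, Differentiable ℝ fun a => f a x) :
    Measurable fun q : ℝ × 𝒳 => score f q.1 q.2 :=
  (measurable_partialA hf.measurable hd).div hf.measurable

/-- Integration by parts: `E[g'(A, X)] = E[-s(A ∣ X) g(A, X)]`. -/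
lemma IsCondDensity.integral_partialA_add_score_mul [IsProbabilityMeasure P]
    (hf : IsCondDensity P f) (hf_diff : ∀ x, Differentiable ℝ (fun a => f a x))
    (hf_top : ∀ x, Tendsto (fun a => f a x) atTop (𝓝 0))
    (hf_bot : ∀ x, Tendsto (fun a => f a x) atBot (𝓝 0)) {g : ℝ → 𝒳 → ℝ}
    (hg : Measurable (Function.uncurry g))
    (hd : ∀ x a, 0 < f a x → DifferentiableAt ℝ (fun b => g b x) a)
    (hbs : BoundedAS P (score f)) (hbg : BoundedAS P g) (hbd : BoundedAS P (partialA g)) :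
    ∫ o, (partialA g (obsA o) (obsX o) + score f (obsA o) (obsX o) * g (obsA o) (obsX o)) ∂P
      = 0 := by
  have : IsProbabilityMeasure (P.map obsX) := Measure.isProbabilityMeasure_map (by fun_prop)
  have : IsProbabilityMeasure (P.map obsAX) := Measure.isProbabilityMeasure_map (by fun_prop)
  have hdens := hf.measurable_ofReal
  obtain ⟨Cs, hCs⟩ := hbs
  obtain ⟨Cg, hCg⟩ := hbg
  obtain ⟨Cd, hCd⟩ := hbd
  have hDm : Measurable ({q : ℝ × 𝒳 | 0 < f q.1 q.2}.indicator fun q => partialA g q.1 q.2) :=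
    (measurable_indicator_partialA (𝒲 := Unit) hf.measurable (g := fun _ => g)
      (hg.comp measurable_snd) fun _ => hd).comp (measurable_const (a := ()).prodMk measurable_id)
  set D := {q : ℝ × 𝒳 | 0 < f q.1 q.2}.indicator fun q => partialA g q.1 q.2 with hD
  have hsm := hf.measurable_score hf_diff
  let G : ℝ × 𝒳 → ℝ := fun q => D q + score f q.1 q.2 * g q.1 q.2
  have hGm : Measurable G := hDm.add (hsm.mul hg)
  have hG : ∀ᵐ o ∂P, ‖G (obsAX o)‖ ≤ Cd + Cs * Cg := by
    filter_upwards [hCs, hCg, hCd, hf.ae_pos] with o h1 h2 h3 h4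
    simp only [G, hD, Set.indicator, Set.mem_ofPred_eq, h4, if_true, Real.norm_eq_abs]
    refine (abs_add_le _ _).trans (add_le_add h3 ?_)
    rw [abs_mul]
    exact mul_le_mul h1 h2 (abs_nonneg _) ((abs_nonneg _).trans h1)
  have hGi : Integrable G (P.map obsAX) :=
    (integrable_map_measure hGm.aestronglyMeasurable measurable_obsAX.aemeasurable).2
      (Integrable.of_bound (hGm.comp measurable_obsAX).aestronglyMeasurable _ hG)
  have e1 : ∫ o, (partialA g (obsA o) (obsX o) +
      score f (obsA o) (obsX o) * g (obsA o) (obsX o)) ∂P = ∫ q, G q ∂(P.map obsAX) := by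
    rw [integral_map measurable_obsAX.aemeasurable hGm.aestronglyMeasurable]
    refine integral_congr_ae ?_
    filter_upwards [hf.ae_pos] with o ho
    simp [G, hD, Set.indicator, ho]
  have hfG : ∀ q : ℝ × 𝒳, (ENNReal.ofReal (f q.1 q.2)).toReal • G q = f q.1 q.2 * G q := fun q => by
    rw [ENNReal.toReal_ofReal (hf.nonneg _ _), smul_eq_mul]
  rw [hf.law_eq] at hGi
  rw [e1, hf.law_eq, integral_withDensity_eq_integral_toReal_smul hdens
    (Eventually.of_forall fun _ => ENNReal.ofReal_lt_top)]
  rw [integrable_withDensity_iff_integrable_smul' hdens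
    (Eventually.of_forall fun _ => ENNReal.ofReal_lt_top)] at hGi
  simp only [hfG] at hGi ⊢
  -- Fubini with `x` outermost: the inner integral over `a` vanishes for almost every `x`.
  rw [integral_prod_symm _ hGi]
  have hB := hf.ae_ae_of_ae (s := {q | |g q.1 q.2| ≤ Cg})
    (measurableSet_le (Measurable.abs hg) measurable_const) hCg
  refine integral_eq_zero_of_ae ?_
  filter_upwards [hGi.prod_left_ae, hB] with x hx hxB
  -- On the support `f s = f'`. At a zero of `f` both sides vanish, because the zero is a minimum
  -- and so `f' = 0` there.
  have hpt : ∀ a, f a x * G (a, x) =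
      deriv (fun b => g b x) a * f a x + g a x * deriv (fun b => f b x) a := fun a => by
    rcases (hf.nonneg a x).lt_or_eq with h | h
    · simp only [G, hD, Set.indicator, Set.mem_ofPred_eq, h, if_true, score, partialA]
      field_simp
    · have hmin : IsLocalMin (fun b => f b x) a := 
        Eventually.of_forall fun b => h.symm.trans_le (hf.nonneg b x)
      rw [hmin.deriv_eq_zero, ← h]; ring
  simp only [hpt] at hx ⊢
  exact integral_deriv_mul_density (fun a => hf.nonneg a x) (hf_diff x) (hf_top x) (hf_bot x)
    (hd x) (abs_le_of_ae_abs_le (hf_diff x).continuous (fun a ha => (hd x a ha).continuousAt) hxB)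
    hx

end Support

/-! ### Consequences of `Y` being binary, and orthogonality of the residual. -/

section Regression

variable {𝒳 : Type*} [MeasurableSpace 𝒳] {P : Measure (Obs 𝒳)} {m : ℝ → 𝒳 → ℝ}

/-- A binary `Y` is almost surely the indicator of `Y = 1`; hence one estimate `μhat` serves for
both `μ` and `p`. -/
lemma IsRegression.condProbOne_ae_eq (hm : IsRegression P m)
    (hY : ∀ᵐ o ∂P, obsY o = 0 ∨ obsY o = 1) :
    condProbOne P =ᵐ[P] fun o => m (obsA o) (obsX o) := by
  refine EventuallyEq.trans (condExp_congr_ae ?_) hm.ae_eq.symm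
  filter_upwards [hY] with o ho
  rcases ho with h | h <;> simp [Set.indicator, h]

variable [IsProbabilityMeasure P]

lemma sigmaAX_le : sigmaAX 𝒳 ≤ (inferInstance : MeasurableSpace (Obs 𝒳)) :=
  measurable_obsAX.comap_le

lemma integrable_obsY (hY : ∀ᵐ o ∂P, obsY o = 0 ∨ obsY o = 1) : Integrable (obsY (𝒳 := 𝒳)) P := by
  refine Integrable.of_bound (C := 1) (Measurable.aestronglyMeasurable (by fun_prop)) ?_
  filter_upwards [hY] with o ho
  rcases ho with h | h <;> simp [h]

lemma IsRegression.ae_mem_Icc (hm : IsRegression P m) (hY : ∀ᵐ o ∂P, obsY o = 0 ∨ obsY o = 1) :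
    ∀ᵐ o ∂P, m (obsA o) (obsX o) ∈ Set.Icc (0 : ℝ) 1 := by
  have h0 : 0 ≤ᵐ[P] P[obsY | sigmaAX 𝒳] := condExp_nonneg (by
    filter_upwards [hY] with o ho
    rcases ho with h | h <;> simp [h])
  have h1 : P[obsY | sigmaAX 𝒳] ≤ᵐ[P] P[fun _ => (1 : ℝ) | sigmaAX 𝒳] :=
    condExp_mono (integrable_obsY hY) (integrable_const 1) (by
      filter_upwards [hY] with o ho
      rcases ho with h | h <;> simp [h])
  rw [condExp_const sigmaAX_le] at h1
  filter_upwards [hm.ae_eq, h0, h1] with o h h0 h1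
  rw [h]
  exact ⟨h0, h1⟩

lemma IsRegression.ae_abs_residual_le (hm : IsRegression P m)
    (hY : ∀ᵐ o ∂P, obsY o = 0 ∨ obsY o = 1) :
    ∀ᵐ o ∂P, |obsY o - m (obsA o) (obsX o)| ≤ 1 := by
  filter_upwards [hY, hm.ae_mem_Icc hY] with o ho h
  rw [abs_le]
  rcases ho with h' | h' <;> rw [h'] <;> constructor <;> linarith [h.1, h.2]

lemma IsRegression.boundedAS (hm : IsRegression P m) (hY : ∀ᵐ o ∂P, obsY o = 0 ∨ obsY o = 1) :
    BoundedAS P m :=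
  ⟨1, (hm.ae_mem_Icc hY).mono fun o h => abs_le.2 ⟨by linarith [h.1], h.2⟩⟩

/-- The residual is orthogonal to functions of `(A, X)`. -/
lemma IsRegression.integral_mul_residual (hm : IsRegression P m)
    (hY : ∀ᵐ o ∂P, obsY o = 0 ∨ obsY o = 1) {k : ℝ × 𝒳 → ℝ} (hk : Measurable k)
    (hki : Integrable (fun o => k (obsAX o)) P) :
    ∫ o, k (obsAX o) * (obsY o - m (obsA o) (obsX o)) ∂P = 0 := by
  have hmm : Measurable fun o : Obs 𝒳 => m (obsA o) (obsX o) := hm.measurable.comp measurable_obsAX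
  have hYi := integrable_obsY hY
  have hmi : Integrable (fun o : Obs 𝒳 => m (obsA o) (obsX o)) P :=
    integrable_condExp.congr hm.ae_eq.symm
  have hsm : StronglyMeasurable[sigmaAX 𝒳] fun o => k (obsAX o) :=
    (hk.comp (comap_measurable obsAX)).stronglyMeasurable
  have hmsm : StronglyMeasurable[sigmaAX 𝒳] fun o : Obs 𝒳 => m (obsA o) (obsX o) :=
    (hm.measurable.comp (comap_measurable obsAX)).stronglyMeasurable
  have hprod : Integrable ((fun o => k (obsAX o)) *
      (obsY - fun o => m (obsA o) (obsX o))) P := by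
    refine hki.mul_bdd (c := 1) (hYi.sub hmi).1 ?_
    filter_upwards [hm.ae_abs_residual_le hY] with o ho using ho
  -- The factor `k(A, X)` is pulled out of the conditional expectation; the residual has conditional
  -- mean zero.
  have h1 := condExp_mul_of_stronglyMeasurable_left hsm hprod (hYi.sub hmi)
  have h2 : P[obsY - (fun o => m (obsA o) (obsX o)) | sigmaAX 𝒳] =ᵐ[P] 0 := by
    refine (condExp_sub hYi hmi _).trans ?_
    rw [condExp_of_stronglyMeasurable sigmaAX_le hmsm hmi]
    filter_upwards [hm.ae_eq] with o ho
    simp [ho]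
  calc _ = ∫ o, (P[(fun o => k (obsAX o)) * (obsY - fun o => m (obsA o) (obsX o)) | sigmaAX 𝒳]) o
        ∂P := (integral_condExp sigmaAX_le).symm
    _ = 0 := by
        refine integral_eq_zero_of_ae ?_
        filter_upwards [h1, h2] with o ho1 ho2
        rw [ho1, Pi.mul_apply, ho2]
        simp

end Regression

lemma memLp_two_and_integral_sq_le {S : Type*} [MeasurableSpace S] {P : Measure S} {v : S → ℝ}
    (hv : AEStronglyMeasurable v P) {ρ : ℝ} (hρ : 0 ≤ ρ) (h : eLpNorm v 2 P ≤ ENNReal.ofReal ρ) :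
    MemLp v 2 P ∧ ∫ o, v o ^ 2 ∂P ≤ ρ ^ 2 := by
  have hm : MemLp v 2 P := ⟨hv, h.trans_lt ENNReal.ofReal_lt_top⟩
  refine ⟨hm, ?_⟩
  rw [hm.eLpNorm_eq_integral_rpow_norm two_ne_zero ENNReal.ofNat_ne_top,
    ENNReal.ofReal_le_ofReal_iff hρ] at h
  simp only [ENNReal.toReal_ofNat, Real.rpow_two, Real.norm_eq_abs, sq_abs] at h
  have h0 : 0 ≤ ∫ o, v o ^ 2 ∂P := integral_nonneg fun _ => sq_nonneg _
  have h2 := pow_le_pow_left₀ (Real.rpow_nonneg h0 _) h 2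
  rwa [← Real.rpow_natCast, ← Real.rpow_mul h0, Nat.cast_ofNat, inv_mul_cancel₀ two_ne_zero,
    Real.rpow_one] at h2

lemma add_four_sq_le (a b c d : ℝ) :
    (a + b + c + d) ^ 2 ≤ 4 * (a ^ 2 + b ^ 2 + c ^ 2 + d ^ 2) := by
  nlinarith [sq_nonneg (a - b), sq_nonneg (a - c), sq_nonneg (a - d), sq_nonneg (b - c),
    sq_nonneg (b - d), sq_nonneg (c - d)]

/-- Needed because the limit theorem is applied to measurable modifications of the influence
functions. -/
lemma IsNegligiblePerturbation.congr {S : Type*} [MeasurableSpace S] {P : Measure S}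
    {φ φ' g g' : S → ℝ} {n : ℕ} {δ : ℝ} (h : IsNegligiblePerturbation P φ g n δ)
    (hφ : φ =ᵐ[P] φ') (hg : g =ᵐ[P] g') : IsNegligiblePerturbation P φ' g' n δ := by
  obtain ⟨d₁, d₂, he, hrest⟩ := h
  refine ⟨d₁, d₂, ?_, hrest⟩
  filter_upwards [he, hφ, hg] with o h1 h2 h3
  rw [← h2, ← h3, h1]

/-! ### Mean of the influence function and its expansion in the nuisance errors. -/

section EfficientInfluenceFunction

variable {𝒳 : Type*} [MeasurableSpace 𝒳] {P : Measure (Obs 𝒳)} {f m : ℝ → 𝒳 → ℝ} {γ t : ℝ}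

lemma phiMax_ae_eq (hY : ∀ᵐ o ∂P, obsY o = 0 ∨ obsY o = 1) (hm : IsRegression P m) :
    phiMax P f m γ t =ᵐ[P] fun o => eifMax γ t (partialA m (obsA o) (obsX o))
      (score f (obsA o) (obsX o)) (m (obsA o) (obsX o)) (m (obsA o) (obsX o)) (obsY o) := by
  filter_upwards [hm.condProbOne_ae_eq hY] with o ho
  simp only [phiMax, ho]

lemma measurable_condProbOne : Measurable (condProbOne P) :=
  (stronglyMeasurable_condExp.mono sigmaAX_le).measurable

lemma IsCondDensity.aemeasurable_phiMax (hf : IsCondDensity P f)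
    (hf_diff : ∀ x, Differentiable ℝ (fun a => f a x)) (hm : IsRegression P m)
    (hm_diff : ∀ x a, 0 < f a x → DifferentiableAt ℝ (fun b => m b x) a) (ht : 0 < t) :
    AEMeasurable (phiMax P f m γ t) P := by
  have h1 := hf.aemeasurable_partialA hm.measurable hm_diff
  have h2 : Measurable fun o : Obs 𝒳 => score f (obsA o) (obsX o) :=
    (hf.measurable_score hf_diff).comp measurable_obsAX
  have h3 : Measurable fun o : Obs 𝒳 => m (obsA o) (obsX o) := hm.measurable.comp measurable_obsAX
  have h4 : Measurable (condProbOne P) := measurable_condProbOne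
  have h5 := (continuous_lse ht).measurable
  have h6 := (continuous_deriv_lse ht).measurable
  have h7 : Measurable (obsY : Obs 𝒳 → ℝ) := by fun_prop
  exact (h1.sub (h2.mul (h7.sub h3)).aemeasurable).add
    (((h5.comp h4).add ((h6.comp h4).mul (h7.sub h4))).const_mul γ).aemeasurable

/-- The Taylor bound based at `p` and evaluated at `0` costs `t p² ≤ t`, and its linear term at most
`1`. -/
lemma abs_lse_le {t : ℝ} (ht : 0 < t) {p : ℝ} (hp : p ∈ Set.Icc (0 : ℝ) 1) :
    |lse t p| ≤ |lse t 0| + t + 1 := by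
  have h := abs_lse_taylor_le ht 0 p
  have h2 := abs_deriv_lse_le ht p
  have h3 : |deriv (lse t) p * (0 - p)| ≤ 1 := by
    rw [abs_mul, zero_sub, abs_neg, abs_of_nonneg hp.1]
    exact mul_le_one₀ h2 hp.1 hp.2
  have h4 : t * (0 - p) ^ 2 ≤ t := by nlinarith [hp.1, hp.2, mul_nonneg hp.1 (sub_nonneg.2 hp.2)]
  have h5 : lse t p = (lse t p + deriv (lse t) p * (0 - p) - lse t 0) + lse t 0 -
      deriv (lse t) p * (0 - p) := by ring
  rw [h5]
  refine (abs_sub _ _).trans ?_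
  have := abs_add_le (lse t p + deriv (lse t) p * (0 - p) - lse t 0) (lse t 0)
  linarith

variable [IsProbabilityMeasure P]

lemma IsCondDensity.memLp_phiMax (hf : IsCondDensity P f)
    (hf_diff : ∀ x, Differentiable ℝ (fun a => f a x))
    (hY : ∀ᵐ o ∂P, obsY o = 0 ∨ obsY o = 1) (hm : IsRegression P m)
    (hm_diff : ∀ x a, 0 < f a x → DifferentiableAt ℝ (fun b => m b x) a) (ht : 0 < t)
    (hbdm : BoundedAS P (partialA m)) (hbs : BoundedAS P (score f)) :
    MemLp (phiMax P f m γ t) 2 P := by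
  obtain ⟨Cd, hCd⟩ := hbdm
  obtain ⟨Cs, hCs⟩ := hbs
  refine MemLp.of_bound (hf.aemeasurable_phiMax hf_diff hm hm_diff ht).aestronglyMeasurable
    (Cd + Cs * 1 + |γ| * ((|lse t 0| + t + 1) + 1 * 1)) ?_
  filter_upwards [phiMax_ae_eq hY hm, hCd, hCs, hm.ae_mem_Icc hY, hm.ae_abs_residual_le hY]
    with o h h1 h2 h3 h4
  rw [h, Real.norm_eq_abs, eifMax]
  refine (abs_add_le _ _).trans (add_le_add ((abs_sub _ _).trans (add_le_add h1 ?_)) ?_)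
  · rw [abs_mul]
    exact mul_le_mul h2 h4 (abs_nonneg _) ((abs_nonneg _).trans h2)
  · rw [abs_mul]
    refine mul_le_mul_of_nonneg_left ((abs_add_le _ _).trans (add_le_add (abs_lse_le ht h3) ?_))
      (abs_nonneg _)
    rw [abs_mul]
    exact mul_le_mul (abs_deriv_lse_le ht _) h4 (abs_nonneg _) zero_le_one

/-- The uncentered influence function has mean the smoothed bound. -/
lemma IsCondDensity.integral_phiMax (hf : IsCondDensity P f)
    (hf_diff : ∀ x, Differentiable ℝ (fun a => f a x))
    (hf_top : ∀ x, Tendsto (fun a => f a x) atTop (𝓝 0))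
    (hf_bot : ∀ x, Tendsto (fun a => f a x) atBot (𝓝 0))
    (hY : ∀ᵐ o ∂P, obsY o = 0 ∨ obsY o = 1) (hm : IsRegression P m)
    (hm_diff : ∀ x a, 0 < f a x → DifferentiableAt ℝ (fun b => m b x) a) (ht : 0 < t)
    (hbdm : BoundedAS P (partialA m)) (hbs : BoundedAS P (score f)) :
    ∫ o, phiMax P f m γ t o ∂P = psiMax P f γ t := by
  have hibp := hf.integral_partialA_add_score_mul hf_diff hf_top hf_bot hm.measurable hm_diff hbs
    (hm.boundedAS hY) hbdm
  obtain ⟨Cd, hCd⟩ := hbdm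
  obtain ⟨Cs, hCs⟩ := hbs
  have hdm := hf.aemeasurable_partialA hm.measurable hm_diff
  have hsm : Measurable fun o : Obs 𝒳 => score f (obsA o) (obsX o) :=
    (hf.measurable_score hf_diff).comp measurable_obsAX
  have hmm : Measurable fun o : Obs 𝒳 => m (obsA o) (obsX o) := hm.measurable.comp measurable_obsAX
  have hYm : Measurable (obsY : Obs 𝒳 → ℝ) := by fun_prop
  have hsi : Integrable (fun o : Obs 𝒳 => score f (obsA o) (obsX o)) P :=
    Integrable.of_bound hsm.aestronglyMeasurable Cs hCs
  have hdi : Integrable (fun o => partialA m (obsA o) (obsX o)) P :=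
    Integrable.of_bound hdm.aestronglyMeasurable Cd hCd
  have hsmi : Integrable (fun o : Obs 𝒳 => score f (obsA o) (obsX o) * m (obsA o) (obsX o)) P := by
    refine hsi.mul_bdd (c := 1) hmm.aestronglyMeasurable ?_
    filter_upwards [hm.ae_mem_Icc hY] with o h
    exact abs_le.2 ⟨by linarith [h.1], h.2⟩
  have hsYi : Integrable (fun o : Obs 𝒳 => -score f (obsA o) (obsX o) * obsY o) P := by
    refine hsi.neg.mul_bdd (c := 1) hYm.aestronglyMeasurable ?_
    filter_upwards [hY] with o h
    rcases h with h | h <;> simp [h]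
  have hli : Integrable (fun o => lse t (condProbOne P o)) P := by
    refine Integrable.of_bound ((continuous_lse ht).measurable.comp
      measurable_condProbOne).aestronglyMeasurable (|lse t 0| + t + 1) ?_
    filter_upwards [hm.ae_mem_Icc hY, hm.condProbOne_ae_eq hY] with o h h'
    rw [h']
    exact abs_lse_le ht h
  have hkm : Measurable fun q : ℝ × 𝒳 => deriv (lse t) (m q.1 q.2) :=
    (continuous_deriv_lse ht).measurable.comp hm.measurable
  have hki : Integrable (fun o : Obs 𝒳 => deriv (lse t) (m (obsA o) (obsX o))) P :=
    Integrable.of_bound (hkm.comp measurable_obsAX).aestronglyMeasurable 1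
      (Eventually.of_forall fun o => abs_deriv_lse_le ht _)
  have hres := hm.integral_mul_residual hY hkm hki
  have hresi : Integrable (fun o : Obs 𝒳 =>
      deriv (lse t) (m (obsA o) (obsX o)) * (obsY o - m (obsA o) (obsX o))) P :=
    hki.mul_bdd (c := 1) (hYm.sub hmm).aestronglyMeasurable (hm.ae_abs_residual_le hY)
  -- The first summand integrates to zero by parts and the last by orthogonality; the middle two
  -- give `psiMax`.
  have hdecomp : phiMax P f m γ t =ᵐ[P] fun o =>
      (partialA m (obsA o) (obsX o) + score f (obsA o) (obsX o) * m (obsA o) (obsX o)) +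
      -score f (obsA o) (obsX o) * obsY o + γ * lse t (condProbOne P o) +
      γ * (deriv (lse t) (m (obsA o) (obsX o)) * (obsY o - m (obsA o) (obsX o))) := by
    filter_upwards [phiMax_ae_eq hY hm, hm.condProbOne_ae_eq hY] with o h h'
    rw [h, h', eifMax]
    ring
  rw [integral_congr_ae hdecomp, integral_add, integral_add, integral_add, hibp,
    integral_const_mul, integral_const_mul, hres, psiMax]
  · ring
  · exact hdi.add hsmi
  · exact hsYi
  · exact (hdi.add hsmi).add hsYi
  · exact hli.const_mul γ
  · exact ((hdi.add hsmi).add hsYi).add (hli.const_mul γ)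
  · exact hresi.const_mul γ

/-- The influence function with estimated nuisances is a perturbation of the true one, with an error
which is quadratic in the errors of the nuisances. -/
theorem IsCondDensity.isNegligiblePerturbation_eifMax (hf : IsCondDensity P f)
    (hf_diff : ∀ x, Differentiable ℝ (fun a => f a x))
    (hf_top : ∀ x, Tendsto (fun a => f a x) atTop (𝓝 0))
    (hf_bot : ∀ x, Tendsto (fun a => f a x) atBot (𝓝 0))
    (hY : ∀ᵐ o ∂P, obsY o = 0 ∨ obsY o = 1) (hm : IsRegression P m)
    (hm_diff : ∀ x a, 0 < f a x → DifferentiableAt ℝ (fun b => m b x) a) (ht : 0 < t)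
    (hbdm : BoundedAS P (partialA m)) {Cs : ℝ}
    (hCs : ∀ᵐ o ∂P, |score f (obsA o) (obsX o)| ≤ Cs)
    {g sh : ℝ → 𝒳 → ℝ} (hg : Measurable (Function.uncurry g))
    (hg_diff : ∀ x a, 0 < f a x → DifferentiableAt ℝ (fun b => g b x) a)
    (hsh : Measurable (Function.uncurry sh)) (hbg : BoundedAS P g) (hbdg : BoundedAS P (partialA g))
    {ρ : ℝ} (hρ : 0 ≤ ρ)
    (hdist : l2dist P g m + l2dist P (partialA g) (partialA m) + l2dist P sh (score f) ≤
      ENNReal.ofReal ρ) {n : ℕ} {δ : ℝ}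
    (hδ : (9 + 4 * Cs ^ 2 + 4 * (|γ| * t) ^ 2 + |γ| * t) * ρ ^ 2 ≤ δ)
    (hnδ : √(n : ℝ) * ((9 + 4 * Cs ^ 2 + 4 * (|γ| * t) ^ 2 + |γ| * t) * ρ ^ 2) ≤ δ) :
    IsNegligiblePerturbation P (phiMax P f m γ t) (fun o => eifMax γ t
      (partialA g (obsA o) (obsX o)) (sh (obsA o) (obsX o)) (g (obsA o) (obsX o))
      (g (obsA o) (obsX o)) (obsY o)) n δ := by
  have hibpm := hf.integral_partialA_add_score_mul hf_diff hf_top hf_bot hm.measurable hm_diff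
    ⟨Cs, hCs⟩ (hm.boundedAS hY) hbdm
  have hibpg := hf.integral_partialA_add_score_mul hf_diff hf_top hf_bot hg hg_diff
    ⟨Cs, hCs⟩ hbg hbdg
  obtain ⟨Cd, hCd⟩ := hbdm
  obtain ⟨Cg, hCg⟩ := hbg
  obtain ⟨Cdg, hCdg⟩ := hbdg
  have hdm := hf.aemeasurable_partialA hm.measurable hm_diff
  have hdg := hf.aemeasurable_partialA hg hg_diff
  have hsm : Measurable fun o : Obs 𝒳 => score f (obsA o) (obsX o) :=
    (hf.measurable_score hf_diff).comp measurable_obsAX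
  have hmm : Measurable fun o : Obs 𝒳 => m (obsA o) (obsX o) := hm.measurable.comp measurable_obsAX
  have hgm : Measurable fun o : Obs 𝒳 => g (obsA o) (obsX o) := hg.comp measurable_obsAX
  have hshm : Measurable fun o : Obs 𝒳 => sh (obsA o) (obsX o) := hsh.comp measurable_obsAX
  have hYm : Measurable (obsY : Obs 𝒳 → ℝ) := by fun_prop
  have hlm := (continuous_lse ht).measurable
  have hl'm := (continuous_deriv_lse ht).measurable
  set u : Obs 𝒳 → ℝ := fun o => partialA g (obsA o) (obsX o) - partialA m (obsA o) (obsX o) with hu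
  set v : Obs 𝒳 → ℝ := fun o => g (obsA o) (obsX o) - m (obsA o) (obsX o) with hv
  set r : Obs 𝒳 → ℝ := fun o => sh (obsA o) (obsX o) - score f (obsA o) (obsX o) with hr
  obtain ⟨hvL, hv2⟩ := memLp_two_and_integral_sq_le (v := v) (hgm.sub hmm).aestronglyMeasurable hρ
    ((le_self_add.trans le_self_add).trans hdist)
  obtain ⟨huL, hu2⟩ := memLp_two_and_integral_sq_le (v := u) (hdg.sub hdm).aestronglyMeasurable hρ
    ((le_add_self.trans le_self_add).trans hdist)
  obtain ⟨hrL, hr2⟩ := memLp_two_and_integral_sq_le (v := r) (hshm.sub hsm).aestronglyMeasurable hρ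
    (le_add_self.trans hdist)
  -- Everything in the error that multiplies the true residual `Y - μ`.
  let k : ℝ × 𝒳 → ℝ := fun q => -(sh q.1 q.2 - score f q.1 q.2) +
    γ * (deriv (lse t) (g q.1 q.2) - deriv (lse t) (m q.1 q.2))
  have hkm : Measurable k := (hsh.sub (hf.measurable_score hf_diff)).neg.add
    (((hl'm.comp hg).sub (hl'm.comp hm.measurable)).const_mul γ)
  have hkb : ∀ o, |k (obsAX o)| ≤ |r o| + |γ| * t * |v o| := fun o => by
    refine (abs_add_le _ _).trans (add_le_add (abs_neg _).le ?_)
    rw [abs_mul, mul_assoc]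
    exact mul_le_mul_of_nonneg_left (abs_deriv_lse_sub_le ht _ _) (abs_nonneg _)
  have hki : Integrable (fun o : Obs 𝒳 => k (obsAX o)) P :=
    Integrable.mono' (((hrL.integrable one_le_two).abs).add
      (((hvL.integrable one_le_two).abs).const_mul (|γ| * t)))
      (hkm.comp measurable_obsAX).aestronglyMeasurable (Eventually.of_forall hkb)
  have hres := hm.integral_mul_residual hY hkm hki
  have hresi : Integrable (fun o : Obs 𝒳 => k (obsAX o) * (obsY o - m (obsA o) (obsX o))) P :=
    hki.mul_bdd (c := 1) (hYm.sub hmm).aestronglyMeasurable (hm.ae_abs_residual_le hY)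
  have hsi : Integrable (fun o : Obs 𝒳 => score f (obsA o) (obsX o)) P :=
    Integrable.of_bound hsm.aestronglyMeasurable Cs hCs
  have himi : Integrable (fun o : Obs 𝒳 => partialA m (obsA o) (obsX o) +
      score f (obsA o) (obsX o) * m (obsA o) (obsX o)) P := by
    refine (Integrable.of_bound hdm.aestronglyMeasurable Cd hCd).add
      (hsi.mul_bdd (c := 1) hmm.aestronglyMeasurable ?_)
    filter_upwards [hm.ae_mem_Icc hY] with o h
    exact abs_le.2 ⟨by linarith [h.1], h.2⟩
  have higi : Integrable (fun o : Obs 𝒳 => partialA g (obsA o) (obsX o) +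
      score f (obsA o) (obsX o) * g (obsA o) (obsX o)) P :=
    (Integrable.of_bound hdg.aestronglyMeasurable Cdg hCdg).add
      (hsi.mul_bdd (c := Cg) hgm.aestronglyMeasurable hCg)
  let d₁ : Obs 𝒳 → ℝ := fun o => (u o + score f (obsA o) (obsX o) * v o) +
    k (obsAX o) * (obsY o - m (obsA o) (obsX o))
  let d₂ : Obs 𝒳 → ℝ := fun o => r o * v o +
    γ * (lse t (g (obsA o) (obsX o)) +
      deriv (lse t) (g (obsA o) (obsX o)) * (m (obsA o) (obsX o) - g (obsA o) (obsX o)) -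
      lse t (m (obsA o) (obsX o)))
  have hd₁m : AEStronglyMeasurable d₁ P :=
    (((hdg.sub hdm).add (hsm.mul (hgm.sub hmm)).aemeasurable).add
      ((hkm.comp measurable_obsAX).mul (hYm.sub hmm)).aemeasurable).aestronglyMeasurable
  have hd₂m : AEStronglyMeasurable d₂ P :=
    (((hshm.sub hsm).mul (hgm.sub hmm)).add ((((hlm.comp hgm).add
      ((hl'm.comp hgm).mul (hmm.sub hgm))).sub (hlm.comp hmm)).const_mul γ)).aestronglyMeasurable
  have hγt : 0 ≤ |γ| * t := mul_nonneg (abs_nonneg _) ht.le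
  have hd₁b : ∀ᵐ o ∂P, |d₁ o| ≤ |u o| + Cs * |v o| + |r o| + |γ| * t * |v o| := by
    filter_upwards [hCs, hm.ae_abs_residual_le hY] with o h1 h2
    have e1 : |d₁ o| ≤ |u o| + |score f (obsA o) (obsX o)| * |v o| +
        |k (obsAX o)| * |obsY o - m (obsA o) (obsX o)| := by
      refine (abs_add_le _ _).trans ?_
      rw [abs_mul, ← abs_mul (score f _ _)]
      exact add_le_add_left (abs_add_le _ _) _
    have e2 := mul_le_mul_of_nonneg_right h1 (abs_nonneg (v o))
    have e3 := mul_le_of_le_one_right (abs_nonneg (k (obsAX o))) h2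
    linarith [hkb o]
  have hd₂b : ∀ o, |d₂ o| ≤ 2⁻¹ * r o ^ 2 + (2⁻¹ + |γ| * t) * v o ^ 2 := fun o => by
    have e1 : |r o * v o| ≤ 2⁻¹ * r o ^ 2 + 2⁻¹ * v o ^ 2 := by
      rw [abs_le]
      constructor <;> nlinarith [sq_nonneg (r o + v o), sq_nonneg (r o - v o)]
    have e2 := mul_le_mul_of_nonneg_left (abs_lse_taylor_le ht (m (obsA o) (obsX o))
      (g (obsA o) (obsX o))) (abs_nonneg γ)
    rw [← abs_mul] at e2
    have e3 : (m (obsA o) (obsX o) - g (obsA o) (obsX o)) ^ 2 = v o ^ 2 := by simp only [hv]; ring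
    rw [e3] at e2
    refine (abs_add_le _ _).trans ?_
    linarith
  have hi2 : ∀ {w : Obs 𝒳 → ℝ}, MemLp w 2 P → Integrable (fun o => w o ^ 2) P :=
    fun h => h.integrable_sq
  have hd₁L : MemLp d₁ 2 P := by
    refine MemLp.mono' (g := fun o => |u o| + Cs * |v o| + |r o| + |γ| * t * |v o|)
      (((huL.abs.add (hvL.abs.const_mul Cs)).add hrL.abs).add (hvL.abs.const_mul (|γ| * t)))
      hd₁m hd₁b
  have hb₂i : Integrable (fun o => 2⁻¹ * r o ^ 2 + (2⁻¹ + |γ| * t) * v o ^ 2) P :=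
    ((hi2 hrL).const_mul _).add ((hi2 hvL).const_mul _)
  -- `d₂` needs only `1 + |γ| t`, and `d₁²` needs `8 + 4 Cs² + 4 (|γ| t)²`; their sum is one
  -- constant for both.
  have hK : ∫ o, |d₂ o| ∂P ≤ (9 + 4 * Cs ^ 2 + 4 * (|γ| * t) ^ 2 + |γ| * t) * ρ ^ 2 := by
    refine (integral_mono_of_nonneg (Eventually.of_forall fun _ => abs_nonneg _) hb₂i
      (Eventually.of_forall hd₂b)).trans ?_
    rw [integral_add ((hi2 hrL).const_mul _) ((hi2 hvL).const_mul _), integral_const_mul,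
      integral_const_mul]
    have := mul_le_mul_of_nonneg_left hv2 hγt
    have : 0 ≤ (8 + 4 * Cs ^ 2 + 4 * (|γ| * t) ^ 2) * ρ ^ 2 := by positivity
    linarith
  refine ⟨d₁, d₂, ?_, hd₁L, ?_, ?_, hb₂i.mono' hd₂m (Eventually.of_forall hd₂b), ?_⟩
  · filter_upwards [phiMax_ae_eq hY hm] with o h
    rw [h]
    simp only [eifMax, d₁, d₂, k, hu, hv, hr]
    ring
  -- The linear part is regrouped as a difference of two integrands, each of mean zero by parts.
  · have e : ∀ o, d₁ o = ((partialA g (obsA o) (obsX o) +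
        score f (obsA o) (obsX o) * g (obsA o) (obsX o)) - (partialA m (obsA o) (obsX o) +
        score f (obsA o) (obsX o) * m (obsA o) (obsX o))) +
        k (obsAX o) * (obsY o - m (obsA o) (obsX o)) := fun o => by
      simp only [d₁, hu, hv]; ring
    refine (integral_congr_ae (Eventually.of_forall e)).trans
      ((integral_add (higi.sub himi) hresi).trans ?_)
    rw [hres, add_zero]
    exact (integral_sub higi himi).trans (by rw [hibpg, hibpm, sub_zero])
  · have hb : ∀ᵐ o ∂P, d₁ o ^ 2 ≤
        4 * u o ^ 2 + (4 * Cs ^ 2 + 4 * (|γ| * t) ^ 2) * v o ^ 2 + 4 * r o ^ 2 := by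
      filter_upwards [hd₁b] with o h
      have h2 := pow_le_pow_left₀ (abs_nonneg _) h 2
      rw [sq_abs] at h2
      have h3 := add_four_sq_le |u o| (Cs * |v o|) |r o| (|γ| * t * |v o|)
      simp only [mul_pow, sq_abs] at h2 h3 ⊢
      linarith
    refine (integral_mono_of_nonneg (Eventually.of_forall fun _ => sq_nonneg _)
      ((((hi2 huL).const_mul 4).add ((hi2 hvL).const_mul _)).add ((hi2 hrL).const_mul 4))
      hb).trans (le_trans ?_ hδ)
    have i1 := (hi2 huL).const_mul 4
    have i2 := (hi2 hvL).const_mul (4 * Cs ^ 2 + 4 * (|γ| * t) ^ 2)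
    have i12 : Integrable
        (fun o => 4 * u o ^ 2 + (4 * Cs ^ 2 + 4 * (|γ| * t) ^ 2) * v o ^ 2) P := i1.add i2
    have i3 := (hi2 hrL).const_mul 4
    change ∫ o, (4 * u o ^ 2 + (4 * Cs ^ 2 + 4 * (|γ| * t) ^ 2) * v o ^ 2 + 4 * r o ^ 2) ∂P ≤ _
    rw [integral_add i12 i3, integral_add i1 i2, integral_const_mul, integral_const_mul,
      integral_const_mul]
    have := mul_le_mul_of_nonneg_left hv2
      (by positivity : 0 ≤ 4 * Cs ^ 2 + 4 * (|γ| * t) ^ 2)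
    have : 0 ≤ (1 + |γ| * t) * ρ ^ 2 := by positivity
    linarith
  · exact (mul_le_mul_of_nonneg_left hK (Real.sqrt_nonneg _)).trans hnδ

end EfficientInfluenceFunction

/-! ### Asymptotic normality of the estimators. -/

/-- Asymptotic normality of the one-step estimator of the smoothed upper bound, for either sign of
the sensitivity parameter. -/
theorem tendstoInDistribution_psiHatMax
    {𝒳 : Type*} [MeasurableSpace 𝒳]
    (P : Measure (Obs 𝒳)) [IsProbabilityMeasure P]
    (hY : ∀ᵐ o ∂P, obsY o = 0 ∨ obsY o = 1)
    (f : ℝ → 𝒳 → ℝ) (hf : IsCondDensity P f)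
    (hf_diff : ∀ x, Differentiable ℝ (fun a => f a x))
    (hf_top : ∀ x, Tendsto (fun a => f a x) atTop (𝓝 0))
    (hf_bot : ∀ x, Tendsto (fun a => f a x) atBot (𝓝 0))
    (μ : ℝ → 𝒳 → ℝ) (hμ : IsRegression P μ)
    (hμ_diff : ∀ x a, 0 < f a x → DifferentiableAt ℝ (fun b => μ b x) a)
    (γ t : ℝ) (ht : 0 < t)
    {Ω : Type*} [MeasurableSpace Ω] (Pr : Measure Ω) [IsProbabilityMeasure Pr]
    (Z : ℕ → Ω → Obs 𝒳) (hZ_meas : ∀ i, Measurable (Z i)) (hZ_law : ∀ i, Pr.map (Z i) = P)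
    (hZ_indep : iIndepFun Z Pr)
    {𝒲 : ℕ → Type*} [∀ n, MeasurableSpace (𝒲 n)]
    (W : (n : ℕ) → Ω → 𝒲 n) (hW_meas : ∀ n, Measurable (W n))
    (hW_indep : ∀ n, IndepFun (W n) (fun ω (i : Fin n) => Z i ω) Pr)
    (μhat shat : (n : ℕ) → 𝒲 n → ℝ → 𝒳 → ℝ)
    (hμhat_meas : ∀ n, Measurable (fun q : 𝒲 n × ℝ × 𝒳 => μhat n q.1 q.2.1 q.2.2))
    (hshat_meas : ∀ n, Measurable (fun q : 𝒲 n × ℝ × 𝒳 => shat n q.1 q.2.1 q.2.2))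
    (hμhat_diff : ∀ n w x a, 0 < f a x → DifferentiableAt ℝ (fun b => μhat n w b x) a)
    (hbdd_dμ : BoundedAS P (partialA μ))
    (hbdd_s : BoundedAS P (score f))
    (hbdd_μhat : ∀ n, ∀ᵐ ω ∂Pr, BoundedAS P (μhat n (W n ω)))
    (hbdd_dμhat : ∀ n, ∀ᵐ ω ∂Pr, BoundedAS P (partialA (μhat n (W n ω))))
    (hrate : IsLittleOp Pr
      (fun n ω => l2dist P (μhat n (W n ω)) μ
        + l2dist P (partialA (μhat n (W n ω))) (partialA μ)
        + l2dist P (shat n (W n ω)) (score f))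
      (fun n => (n : ℝ) ^ (-(1 / 4) : ℝ))) :
    TendstoInDistribution
      (fun (n : ℕ) ω => √(n : ℝ) *
        (psiHatMax γ t (μhat n (W n ω)) (shat n (W n ω)) n (fun i => Z i ω) - psiMax P f γ t))
      atTop (id : ℝ → ℝ) (fun _ => Pr)
      (gaussianReal 0 (Var[phiMax P f μ γ t; P]).toNNReal) := by
  have haem := hf.aemeasurable_phiMax (γ := γ) hf_diff hμ hμ_diff ht
  have hLp := hf.memLp_phiMax (γ := γ) hf_diff hY hμ hμ_diff ht hbdd_dμ hbdd_s
  have hmean := hf.integral_phiMax (γ := γ) hf_diff hf_top hf_bot hY hμ hμ_diff ht hbdd_dμ hbdd_s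
  -- `phiMax` is only almost everywhere measurable, since nothing controls `∂ₐ μ` off the support.
  -- `φ` is a measurable version, and `D` below cuts off `∂ₐ μhat` for the same reason.
  set φ := haem.mk _ with hφ
  have hφae : phiMax P f μ γ t =ᵐ[P] φ := haem.ae_eq_mk
  let D : (n : ℕ) → 𝒲 n × ℝ × 𝒳 → ℝ := fun n => {q : 𝒲 n × ℝ × 𝒳 | 0 < f q.2.1 q.2.2}.indicator
    fun q => partialA (μhat n q.1) q.2.1 q.2.2
  have hD : ∀ n, Measurable (D n) := fun n =>
    measurable_indicator_partialA hf.measurable (hμhat_meas n) (hμhat_diff n)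
  have hDeq : ∀ n w (o : Obs 𝒳), 0 < f (obsA o) (obsX o) →
      D n (w, obsAX o) = partialA (μhat n w) (obsA o) (obsX o) := fun n w o ho => by
    simp [D, ho]
  let Φ : (n : ℕ) → 𝒲 n → Obs 𝒳 → ℝ := fun n w o => eifMax γ t (D n (w, obsAX o))
    (shat n w (obsA o) (obsX o)) (μhat n w (obsA o) (obsX o)) (μhat n w (obsA o) (obsX o)) (obsY o)
  have hΦ : ∀ n, Measurable (Function.uncurry (Φ n)) := fun n => by
    have hq : Measurable fun q : 𝒲 n × Obs 𝒳 => (q.1, obsAX q.2) :=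
      measurable_fst.prodMk (measurable_obsAX.comp measurable_snd)
    have h1 := (hD n).comp hq
    have h2 := (hshat_meas n).comp hq
    have h3 := (hμhat_meas n).comp hq
    have h4 : Measurable fun q : 𝒲 n × Obs 𝒳 => obsY q.2 := by fun_prop
    exact (h1.sub (h2.mul (h4.sub h3))).add
      ((((continuous_lse ht).measurable.comp h3).add
        (((continuous_deriv_lse ht).measurable.comp h3).mul (h4.sub h3))).const_mul γ)
  have hvar : Var[phiMax P f μ γ t; P] = Var[φ; P] := variance_congr hφae
  have hmeanφ : ∫ o, φ o ∂P = psiMax P f γ t := (integral_congr_ae hφae).symm.trans hmean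
  have hgood : ∀ δ : ℝ, 0 < δ → Tendsto
      (fun n => Pr {ω | ¬ IsNegligiblePerturbation P φ (Φ n (W n ω)) n δ}) atTop (𝓝 0) := by
    intro δ hδ
    obtain ⟨Cs, hCs⟩ := hbdd_s
    set K := 9 + 4 * Cs ^ 2 + 4 * (|γ| * t) ^ 2 + |γ| * t with hK
    have hK0 : 0 < K := by positivity
    -- Chosen so that `ρ = ε n^(-1/4)` satisfies `√n K ρ² = δ` exactly.
    set ε := √(δ / K) with hε
    have hε0 : 0 < ε := Real.sqrt_pos.2 (div_pos hδ hK0)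
    have hKε : K * ε ^ 2 = δ := by
      rw [hε, Real.sq_sqrt (div_pos hδ hK0).le]; field_simp
    refine tendsto_of_tendsto_of_tendsto_of_le_of_le' tendsto_const_nhds (hrate ε hε0)
      (Eventually.of_forall fun _ => zero_le) ?_
    filter_upwards [eventually_ge_atTop 1] with n hn
    refine measure_mono_ae ?_
    filter_upwards [hbdd_μhat n, hbdd_dμhat n] with ω h1 h2 hω
    by_contra hcon
    refine hω ?_
    have hn1 : (1 : ℝ) ≤ n := by exact_mod_cast hn
    have hρ : 0 ≤ ε * (n : ℝ) ^ (-(1 / 4) : ℝ) := by positivity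
    have hρ2 : √(n : ℝ) * (K * (ε * (n : ℝ) ^ (-(1 / 4) : ℝ)) ^ 2) = δ := by
      have : √(n : ℝ) * ((n : ℝ) ^ (-(1 / 4) : ℝ)) ^ 2 = 1 := by
        rw [← Real.rpow_natCast, ← Real.rpow_mul (by positivity), Real.sqrt_eq_rpow,
          ← Real.rpow_add (by positivity)]
        norm_num
      rw [mul_pow, ← hKε]
      linear_combination (K * ε ^ 2) * this
    -- For `n ≥ 1` the bound on `√n K ρ²` also bounds `K ρ²`.
    have hsq : 1 ≤ √(n : ℝ) := Real.one_le_sqrt.2 hn1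
    have hle := (not_le.1 hcon).le
    refine (hf.isNegligiblePerturbation_eifMax hf_diff hf_top hf_bot hY hμ hμ_diff ht hbdd_dμ hCs
      (g := μhat n (W n ω)) (sh := shat n (W n ω))
      ((hμhat_meas n).comp measurable_prodMk_left) (hμhat_diff n (W n ω))
      ((hshat_meas n).comp measurable_prodMk_left) h1 h2 hρ hle
      ((le_mul_of_one_le_left (by positivity) hsq).trans hρ2.le) hρ2.le).congr hφae ?_
    filter_upwards [hf.ae_pos] with o ho
    simp only [Φ, hDeq n _ o ho]
  have hmain := tendstoInDistribution_crossfit hZ_meas hZ_law hZ_indep hW_meas hW_indep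
    haem.measurable_mk (hLp.ae_eq hφae) hΦ hgood
  rw [hvar]
  refine hmain.congr (fun n => ?_) EventuallyEq.rfl
  -- Almost surely every observation lies in the support, where the cut-off derivative is the true
  -- one.
  have hpos : ∀ᵐ ω ∂Pr, ∀ i, 0 < f (obsA (Z i ω)) (obsX (Z i ω)) := by
    refine ae_all_iff.2 fun i => ?_
    have := hf.ae_pos
    rw [← hZ_law i] at this
    exact ae_of_ae_map (hZ_meas i).aemeasurable this
  filter_upwards [hpos] with ω hω
  simp only [Φ, psiHatMax, ← hφ, hmeanφ, hDeq n _ _ (hω _)]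

lemma eifMin_eq (γ t dm s m p y : ℝ) : eifMin γ t dm s m p y = eifMax (-γ) t dm s m p y := by
  simp only [eifMin, eifMax]; ring

end ADE

theorem mainTheorem2
    {𝒳 : Type*} [MeasurableSpace 𝒳]
    -- the law `P` of an observation `(X, A, Y)`, with `Y` binary
    (P : Measure (ADE.Obs 𝒳)) [IsProbabilityMeasure P]
    (hY : ∀ᵐ o ∂P, ADE.obsY o = 0 ∨ ADE.obsY o = 1)
    -- the conditional density `f(a ∣ x)`: differentiable in `a`, vanishing as `|a| → ∞`
    (f : ℝ → 𝒳 → ℝ) (hf : ADE.IsCondDensity P f)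
    (hf_diff : ∀ x, Differentiable ℝ (fun a => f a x))
    (hf_top : ∀ x, Tendsto (fun a => f a x) atTop (𝓝 0))
    (hf_bot : ∀ x, Tendsto (fun a => f a x) atBot (𝓝 0))
    -- the regression `μ(a, x) = E[Y ∣ A = a, X = x]`, differentiable in `a` on the support
    (μ : ℝ → 𝒳 → ℝ) (hμ : ADE.IsRegression P μ)
    (hμ_diff : ∀ x a, 0 < f a x → DifferentiableAt ℝ (fun b => μ b x) a)
    -- sensitivity parameter and smoothing parameter
    (γ t : ℝ) (ht : 0 < t)
    -- the i.i.d. estimation sample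
    {Ω : Type*} [MeasurableSpace Ω] (Pr : Measure Ω) [IsProbabilityMeasure Pr]
    (Z : ℕ → Ω → ADE.Obs 𝒳) (hZ_meas : ∀ i, Measurable (Z i)) (hZ_law : ∀ i, Pr.map (Z i) = P)
    (hZ_indep : iIndepFun Z Pr)
    -- the training data `W n`, independent of the estimation sample `Z 0, …, Z (n - 1)`
    {𝒲 : ℕ → Type*} [∀ n, MeasurableSpace (𝒲 n)]
    (W : (n : ℕ) → Ω → 𝒲 n) (hW_meas : ∀ n, Measurable (W n))
    (hW_indep : ∀ n, IndepFun (W n) (fun ω (i : Fin n) => Z i ω) Pr)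
    -- the nuisance estimates of `μ` and `s`, functions of the training data
    (μhat shat : (n : ℕ) → 𝒲 n → ℝ → 𝒳 → ℝ)
    (hμhat_meas : ∀ n, Measurable (fun q : 𝒲 n × ℝ × 𝒳 => μhat n q.1 q.2.1 q.2.2))
    (hshat_meas : ∀ n, Measurable (fun q : 𝒲 n × ℝ × 𝒳 => shat n q.1 q.2.1 q.2.2))
    (hμhat_diff : ∀ n w x a, 0 < f a x → DifferentiableAt ℝ (fun b => μhat n w b x) a)
    -- almost sure boundedness
    (hbdd_dμ : ADE.BoundedAS P (ADE.partialA μ))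
    (hbdd_s : ADE.BoundedAS P (ADE.score f))
    (hbdd_μhat : ∀ n, ∀ᵐ ω ∂Pr, ADE.BoundedAS P (μhat n (W n ω)))
    (hbdd_dμhat : ∀ n, ∀ᵐ ω ∂Pr, ADE.BoundedAS P (ADE.partialA (μhat n (W n ω))))
    (hbdd_shat : ∀ n, ∀ᵐ ω ∂Pr, ADE.BoundedAS P (shat n (W n ω)))
    -- the rate of the nuisance estimates
    (hrate : ADE.IsLittleOp Pr
      (fun n ω => ADE.l2dist P (μhat n (W n ω)) μ
        + ADE.l2dist P (ADE.partialA (μhat n (W n ω))) (ADE.partialA μ)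
        + ADE.l2dist P (shat n (W n ω)) (ADE.score f))
      (fun n => (n : ℝ) ^ (-(1 / 4) : ℝ))) :
    TendstoInDistribution
      (fun (n : ℕ) ω => √(n : ℝ) *
        (ADE.psiHatMax γ t (μhat n (W n ω)) (shat n (W n ω)) n (fun i => Z i ω)
          - ADE.psiMax P f γ t))
      atTop (id : ℝ → ℝ) (fun _ => Pr)
      (gaussianReal 0 (Var[ADE.phiMax P f μ γ t; P]).toNNReal) ∧
    TendstoInDistribution
      (fun (n : ℕ) ω => √(n : ℝ) *
        (ADE.psiHatMin γ t (μhat n (W n ω)) (shat n (W n ω)) n (fun i => Z i ω)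
          - ADE.psiMin P f γ t))
      atTop (id : ℝ → ℝ) (fun _ => Pr)
      (gaussianReal 0 (Var[ADE.phiMin P f μ γ t; P]).toNNReal) := by
  -- Kept general in `γ`, to be used at both `γ` and `-γ`.
  have key := fun γ : ℝ => ADE.tendstoInDistribution_psiHatMax P hY f hf hf_diff hf_top hf_bot μ hμ
    hμ_diff γ t ht Pr Z hZ_meas hZ_law hZ_indep W hW_meas hW_indep μhat shat hμhat_meas hshat_meas
    hμhat_diff hbdd_dμ hbdd_s hbdd_μhat hbdd_dμhat hrate
  refine ⟨key γ, ?_⟩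
  have hphi : ADE.phiMin P f μ γ t = ADE.phiMax P f μ (-γ) t :=
    funext fun o => ADE.eifMin_eq _ _ _ _ _ _ _
  have hpsi : ADE.psiMin P f γ t = ADE.psiMax P f (-γ) t := by
    simp only [ADE.psiMin, ADE.psiMax]; ring
  simp only [hphi, hpsi, ADE.psiHatMin, ADE.eifMin_eq]
  exact key (-γ)
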